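/- All logarithms are to base $2$ and $C_n$ denotes the $n$-th Catalan number. For integers $U,m\ge 1$, a random $m$-element set $S\subseteq\{1,\dots,U\}$ is said to have the Catalan law if, for all $0=s_0<s_1<\dots<s_m<s_{m+1}=U+1$, $$\Pr[S=\{s_1,\dots,s_m\}]=\frac1{M(U,m)}\prod_{j=0}^m C_{s_{j+1}-s_j-1},$$ where $M(U,m)$ is the normalising constant. For all constants $\alpha,\beta>0$ there are constants $C>0$ and $B_0$ such that the following holds. Let $B\ge B_0$ and $m\le B$ be integers, let $k=\log^4 B$ and $L=\lfloor m^2/k\rfloor$, assume $L\ge 1$, and let $U$ be an integer with $\alpha m^2\le U\le\beta m^2$. Let $S$ have the Catalan law with parameters $U,m$, let $\Delta$ be uniform in $\{1,\dots,L\}$ and independent of $S$, and let $E_j\in\{0,1\}$ indicate that the interval $[\Delta+jL,\Delta+(j+1)L)$ contains at least one point of $S$ ($j\in\mathbb Z$). Let $S'$ be a random set with $S'\subseteq S$ almost surely, defined on the same probability space as $(S,\Delta)$ and otherwise arbitrarily correlated with $(S,\Delta)$, and put $\varepsilon=\mathbb E[1-|S'|/m]$. Then there is a map that assigns to each possible value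 of $(\Delta,S,S')$ (an offset in $\{1,\dots,L\}$, an $m$-element subset of $\{1,\dots,U\}$, and a subset of it) a binary string $\mathrm{ext}_{\Delta,S}(S')$ such that 1. the set of all these strings is prefix-free; 2. $\mathrm{ext}_{\Delta,S}(S')$ and $S'$ together determine $(E_j)_{j\in\mathbb Z}$, that is, the set of non-empty intervals (in particular they determine $E_j$ for $1\le j\le K=\lfloor U/L\rfloor$); 3. $$\mathbb E\bigl[\,|\mathrm{ext}_{\Delta,S}(S')|\,\bigr]\le C\left(\sqrt{\varepsilon}\,\log^2 B\,\log(2/\varepsilon)+\log B\,\log\log B\right),$$ where the first term is read as $0$ when $\varepsilon=0$. -/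

import Mathlib

open scoped ENNReal

namespace CatalanBlock

/-- For `T = {s₁ < ⋯ < sₘ}`, the sequence `s₀ = 0, s₁, …, sₘ, sₘ₊₁ = U + 1`
(indices beyond `m + 1` are irrelevant). -/
def pt (U : ℕ) (T : Finset ℕ) (j : ℕ) : ℕ :=
  (0 :: (T.sort (· ≤ ·) ++ [U + 1])).getD j 0

/-- The weight `∏_{j=0}^{m} C_{s_{j+1} - s_j - 1}` of `T = {s₁ < ⋯ < sₘ} ⊆ {1, …, U}`,
where `C_n` is the `n`-th Catalan number. -/
def weight (U : ℕ) (T : Finset ℕ) : ℕ :=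
  ∏ j ∈ Finset.range (T.card + 1), catalan (pt U T (j + 1) - pt U T j - 1)

/-- The `m`-element subsets of `{1, …, U}`. -/
def subsets (U m : ℕ) : Finset (Finset ℕ) :=
  (Finset.Icc 1 U).powersetCard m

/-- The normalising constant `M(U, m)`. -/
def M (U m : ℕ) : ℕ := ∑ T ∈ subsets U m, weight U T

/-- The probability mass `Pr[S = T]` of the random `m`-element set `S ⊆ {1, …, U}`. -/
noncomputable def setProb (U m : ℕ) (T : Finset ℕ) : ℝ :=
  if T ∈ subsets U m then (weight U T : ℝ) / (M U m : ℝ) else 0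

/-- The probability mass of a uniformly random offset in `{1, …, L}`. -/
noncomputable def offsetProb (L δ : ℕ) : ℝ :=
  if δ ∈ Finset.Icc 1 L then 1 / (L : ℝ) else 0

/-- The interval length `L = ⌊m² / k⌋` with `k = log⁴ B`. -/
noncomputable def intervalLen (B m : ℕ) : ℕ :=
  ⌊(m : ℝ) ^ 2 / (Real.logb 2 (B : ℝ)) ^ 4⌋₊

/-- The indicator `E_j` that `[δ + j L, δ + (j + 1) L)` contains at least one point of `T`. -/
def E (L δ : ℕ) (T : Finset ℕ) (j : ℤ) : Bool :=
  decide (∃ s ∈ T, (δ : ℤ) + j * (L : ℤ) ≤ (s : ℤ) ∧ (s : ℤ) < (δ : ℤ) + (j + 1) * (L : ℤ))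

/-- The possible values `(δ, T, T')` of `(Δ, S, S')`. -/
def Valid (L U m δ : ℕ) (T T' : Finset ℕ) : Prop :=
  δ ∈ Finset.Icc 1 L ∧ T ∈ subsets U m ∧ T' ⊆ T

/-- The set of all strings `ext δ T T'` over the possible values is prefix-free:
no codeword is a proper prefix of another one. -/
def PrefixFree (L U m : ℕ) (ext : ℕ → Finset ℕ → Finset ℕ → List Bool) : Prop :=
  ∀ δ₁ T₁ T₁' δ₂ T₂ T₂', Valid L U m δ₁ T₁ T₁' → Valid L U m δ₂ T₂ T₂' →
    ext δ₁ T₁ T₁' <+: ext δ₂ T₂ T₂' → ext δ₁ T₁ T₁' = ext δ₂ T₂ T₂'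

/-- The string `ext δ T T'` and the set `T'` together determine all the indicators `E_j`. -/
def Determines (L U m : ℕ) (ext : ℕ → Finset ℕ → Finset ℕ → List Bool) : Prop :=
  ∃ dec : List Bool → Finset ℕ → ℤ → Bool,
    ∀ δ T T', Valid L U m δ T T' → ∀ j : ℤ, dec (ext δ T T') T' j = E L δ T j

end CatalanBlock

namespace CatalanBlock

open Finset

/-! The weight of a set is a product over its gaps. The tilt `2 * 4 ^ n` turns the Catalan numbers
into a probability law `gapProb` without changing the Catalan law, because the gaps have a fixed
sum. So the gap vector consists of `m + 1` independent heavy-tailed gaps (tail about `1 / √n`)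
conditioned on their sum. A sum of `r` gaps is essentially a hitting time of simple random walk: its
atoms are at most `16 / r ^ 2` (`sumProb_le`), while the conditioning event has probability at least
`c / m ^ 2` (`exists_le_sumProb`). Hence, up to a constant `K`, any two gaps may be treated as
independent (`sum_setProb_mul_le`).

The codeword states the offset and then lists only the non-empty intervals missed by `S'`. Each is
located by the number of known non-empty intervals since the last listed one and by its distance
from the preceding non-empty interval. A number `a` has at most `H + a / 2 ^ H` bits, and a distance
costs `H` bits plus an excess, so the length is of order log L + H · (missed intervals) + (non-empty
intervals) / 2 ^ H + excess (`length_code_le`).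

A missed interval either has at most `t` points of `S`, or accounts for more than `t` lost points
(`mul_card_missed_le`). Apart from two intervals at the ends, a sparse one forces two interval
boundaries near the same short run of points. Over the random offset this has probability at most
twice the product of the single bounds min(L, distance) / L (`mul_card_blk_lt_lt_le`). A gap
truncated at `L` has mean O(√L), so about m t / L sparse intervals are expected. The set `S'` enters
only through the number of lost points, of mean m ε, so its correlation with the rest is harmless.

Write ℓ = log B, so that m / √L is of order ℓ². With η = max(√ε, 1/ℓ), t about η m / ℓ² and 2 ^ H
about η⁻², every term is O(η ℓ² (1 + log(1/η))) (`total_length_le`), which is the claimed bound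
(`exists_threshold`). -/

/-! ### The gap law and the hitting time formula -/

/-- The law of the gap minus one: `C_n / (2 * 4 ^ n)`. -/
noncomputable def gapProb (n : ℕ) : ℝ := (catalan n : ℝ) / (2 * 4 ^ n)

lemma gapProb_nonneg (n : ℕ) : 0 ≤ gapProb n := by unfold gapProb; positivity

/-- The generating function of `gapProb`. -/
noncomputable def gapSeries : PowerSeries ℝ := PowerSeries.mk gapProb

/-- This is the Catalan convolution recursion after rescaling, and also the first-step equation of
simple random walk. -/
lemma two_mul_gapSeries : 2 * gapSeries = 1 + PowerSeries.X * gapSeries ^ 2 := by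
  ext n
  rw [mul_comm PowerSeries.X, ← map_ofNat (PowerSeries.C (R := ℝ)) 2]
  rcases n with _ | n
  · simp [gapSeries, gapProb, PowerSeries.coeff_C_mul]
  · rw [map_add, PowerSeries.coeff_succ_mul_X, PowerSeries.coeff_one, PowerSeries.coeff_C_mul, sq,
      PowerSeries.coeff_mul]
    simp only [gapSeries, PowerSeries.coeff_mk, gapProb]
    rw [catalan_succ']
    push_cast
    simp only [zero_add]
    rw [Finset.sum_div, Finset.mul_sum]
    refine Finset.sum_congr rfl fun x hx => ?_
    rw [HasAntidiagonal.mem_antidiagonal] at hx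
    rw [← hx]
    field_simp
    ring

/-- The `n`-th coefficient of the `r`-th power of `gapSeries`: the law of a sum of `r` gaps. -/
noncomputable def sumProb (r n : ℕ) : ℝ := PowerSeries.coeff n (gapSeries ^ r)

lemma two_mul_sumProb_succ_succ (r n : ℕ) :
    2 * sumProb (r + 1) (n + 1) = sumProb r (n + 1) + sumProb (r + 2) n := by
  have h : PowerSeries.C (2 : ℝ) * gapSeries ^ (r + 1) =
      gapSeries ^ r + gapSeries ^ (r + 2) * PowerSeries.X := by
    have := two_mul_gapSeries
    rw [map_ofNat]
    linear_combination gapSeries ^ r * this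
  have := congrArg (PowerSeries.coeff (n + 1)) h
  rwa [PowerSeries.coeff_C_mul, map_add, PowerSeries.coeff_succ_mul_X] at this

lemma sumProb_zero_right (r : ℕ) : sumProb r 0 = (1 / 2) ^ r := by
  simp [sumProb, gapSeries, gapProb]

/-- Induction on the number `N` of walk steps: one step from height `r + 1` leads to height `r` or
`r + 2`, and Pascal's rule matches this recursion on the binomial side. -/
lemma mul_sumProb_aux (N : ℕ) : ∀ n r : ℕ, 2 * n + r = N →
    (N : ℝ) * (sumProb r n * 2 ^ N) = r * N.choose n := by
  induction N with
  | zero => intro n r h; obtain ⟨rfl, rfl⟩ : n = 0 ∧ r = 0 := by omega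
            simp
  | succ N ih =>
    intro n r h
    rcases n with _ | n
    · obtain rfl : r = N + 1 := by omega
      rw [sumProb_zero_right]
      simp
    rcases r with _ | r
    · simp [sumProb, PowerSeries.coeff_one]
    have h1 := ih (n + 1) r (by omega)
    have h2 := ih n (r + 2) (by omega)
    have h3 := two_mul_sumProb_succ_succ r n
    have hN : (N : ℝ) = 2 * n + r + 2 := by
      have : N = 2 * n + r + 2 := by omega
      exact_mod_cast this
    have hN0 : (N : ℝ) ≠ 0 := by rw [hN]; positivity
    have c1 : ((N + 1).choose (n + 1) : ℝ) = N.choose n + N.choose (n + 1) := by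
      exact_mod_cast Nat.choose_succ_succ N n
    have c2 : ((N : ℝ) + 1) * N.choose n = (N + 1).choose (n + 1) * (n + 1) := by
      exact_mod_cast Nat.add_one_mul_choose_eq N n
    apply mul_left_cancel₀ hN0
    push_cast at h1 h2 ⊢
    have e : (N : ℝ) * ((N + 1) * (sumProb (r + 1) (n + 1) * 2 ^ (N + 1))) =
        (N + 1) * (N * (sumProb r (n + 1) * 2 ^ N) + N * (sumProb (r + 2) n * 2 ^ N)) := by
      rw [pow_succ]
      linear_combination (N : ℝ) * (N + 1) * 2 ^ N * h3
    rw [e, h1, h2]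
    have c3 : (N.choose (n + 1) : ℝ) = (N + 1).choose (n + 1) - N.choose n := by linarith
    rw [c3]
    have hr : (r : ℝ) = N - 2 * n - 2 := by linarith
    rw [hr]
    linear_combination 2 * c2

/-- The hitting time formula. -/
lemma mul_sumProb (r n : ℕ) :
    ((2 * n + r : ℕ) : ℝ) * (sumProb r n * 2 ^ (2 * n + r)) = r * (2 * n + r).choose n :=
  mul_sumProb_aux _ n r rfl

lemma sumProb_nonneg (r n : ℕ) : 0 ≤ sumProb r n := by
  rcases Nat.eq_zero_or_pos (2 * n + r) with h | h
  · obtain ⟨rfl, rfl⟩ : n = 0 ∧ r = 0 := by omega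
    simp [sumProb]
  have := mul_sumProb r n
  have h' : (0 : ℝ) < ((2 * n + r : ℕ) : ℝ) := by exact_mod_cast h
  have h2 : 0 ≤ ((2 * n + r : ℕ) : ℝ) * (sumProb r n * 2 ^ (2 * n + r)) := by
    rw [this]; positivity
  have h3 := nonneg_of_mul_nonneg_right h2 h'
  exact nonneg_of_mul_nonneg_left h3 (by positivity)

/-! ### Upper bound for the atoms -/

lemma sum_choose_mul_sq (N : ℕ) :
    ∑ j ∈ range (N + 1), (N.choose j : ℝ) * ((N : ℝ) - 2 * j) ^ 2 = (N : ℝ) * 2 ^ N := by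
  have h := congrArg (Polynomial.eval (1 / 2 : ℝ)) (bernsteinPolynomial.variance ℝ N)
  simp only [bernsteinPolynomial, Polynomial.eval_finsetSum, Polynomial.eval_mul,
    Polynomial.eval_pow, Polynomial.eval_sub, Polynomial.eval_natCast,
    Polynomial.eval_X, Polynomial.eval_one, nsmul_eq_mul] at h
  have e : ∑ j ∈ range (N + 1), (N.choose j : ℝ) * ((N : ℝ) - 2 * j) ^ 2 = 4 * 2 ^ N *
      ∑ x ∈ range (N + 1), ((N : ℝ) * (1 / 2) - x) ^ 2 *
        ((N.choose x : ℝ) * (1 / 2) ^ x * (1 - 1 / 2) ^ (N - x)) := by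
    rw [mul_sum]
    refine sum_congr rfl fun j hj => ?_
    have hj' : j ≤ N := by simpa [Nat.lt_succ_iff] using hj
    have : ((1 : ℝ) / 2) ^ j * (1 - 1 / 2) ^ (N - j) = 1 / 2 ^ N := by
      rw [show (1 : ℝ) - 1 / 2 = 1 / 2 by norm_num, ← pow_add, Nat.add_sub_cancel' hj']; simp
    rw [mul_assoc (N.choose j : ℝ), this]
    field_simp
    ring
  rw [e, h]
  ring

lemma choose_le_choose_of_le_half {N a b : ℕ} (hab : a ≤ b) (hb : 2 * b ≤ N) :
    N.choose a ≤ N.choose b := by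
  induction b, hab using Nat.le_induction with
  | base => exact le_rfl
  | succ b hab ih =>
    exact (ih (by omega)).trans (Nat.choose_le_succ_of_lt_half_left (by omega))

/-- A Chebyshev argument: the more than `r / 4` indices from `n` to `n + r / 4` all have binomials
at least that of `n` and satisfy `N - 2 * j ≥ r / 2`, so they contribute at least `r ^ 3 / 16` times
that binomial to a second moment equal to `N * 2 ^ N`. -/
lemma cube_mul_choose_le (r n : ℕ) :
    (r : ℝ) ^ 3 * (2 * n + r).choose n ≤ 16 * ((2 * n + r : ℕ) : ℝ) * 2 ^ (2 * n + r) := by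
  have h := sum_choose_mul_sq (2 * n + r)
  have h1 : ∑ j ∈ Icc n (n + r / 4), ((2 * n + r).choose n : ℝ) * ((r : ℝ) / 2) ^ 2 ≤
      ∑ j ∈ range (2 * n + r + 1),
        ((2 * n + r).choose j : ℝ) * (((2 * n + r : ℕ) : ℝ) - 2 * j) ^ 2 := by
    refine (sum_le_sum fun j hj => ?_).trans
      (sum_le_sum_of_subset_of_nonneg (s := Icc n (n + r / 4)) ?_ fun j _ _ => by positivity)
    · rw [mem_Icc] at hj
      have hc : ((2 * n + r).choose n : ℝ) ≤ (2 * n + r).choose j := by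
        exact_mod_cast choose_le_choose_of_le_half hj.1 (by omega)
      have h4 : (4 * j : ℝ) ≤ 4 * n + r := by exact_mod_cast (by omega : 4 * j ≤ 4 * n + r)
      have : (r : ℝ) / 2 ≤ ((2 * n + r : ℕ) : ℝ) - 2 * j := by push_cast; linarith
      gcongr
    · intro j hj
      rw [mem_Icc] at hj
      rw [mem_range]; omega
  rw [h, sum_const, nsmul_eq_mul, Nat.card_Icc] at h1
  have hr : (r : ℝ) / 4 ≤ ((n + r / 4 + 1 - n : ℕ) : ℝ) := by
    rw [div_le_iff₀ (by norm_num)]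
    exact_mod_cast (by omega : r ≤ (n + r / 4 + 1 - n) * 4)
  have h2 : (r : ℝ) / 4 * (((2 * n + r).choose n : ℝ) * ((r : ℝ) / 2) ^ 2) ≤ _ :=
    (mul_le_mul_of_nonneg_right hr (by positivity)).trans h1
  nlinarith [h2]

/-- A sum of `r` gaps has atoms at most `16 / r ^ 2`. -/
lemma sumProb_le {r : ℕ} (hr : 0 < r) (n : ℕ) : sumProb r n ≤ 16 / (r : ℝ) ^ 2 := by
  have h1 := mul_sumProb r n
  have h2 := cube_mul_choose_le r n
  have hN : (0 : ℝ) < ((2 * n + r : ℕ) : ℝ) := by exact_mod_cast (by omega : 0 < 2 * n + r)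
  have hr' : (0 : ℝ) < r := by exact_mod_cast hr
  rw [le_div_iff₀ (by positivity)]
  have hP : (0 : ℝ) < ((2 * n + r : ℕ) : ℝ) * 2 ^ (2 * n + r) := by positivity
  refine le_of_mul_le_mul_right ?_ hP
  calc sumProb r n * (r : ℝ) ^ 2 * (((2 * n + r : ℕ) : ℝ) * 2 ^ (2 * n + r))
      = (r : ℝ) ^ 2 * (((2 * n + r : ℕ) : ℝ) * (sumProb r n * 2 ^ (2 * n + r))) := by ring
    _ = (r : ℝ) ^ 3 * ((2 * n + r).choose n : ℝ) := by rw [h1]; ring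
    _ ≤ 16 * (((2 * n + r : ℕ) : ℝ) * 2 ^ (2 * n + r)) := by rw [← mul_assoc]; exact h2

/-! ### Tail and truncated mean of a gap -/

/-- `centralBinom n / 4 ^ n`, the probability that a gap exceeds `n`. -/
noncomputable def tailProb (n : ℕ) : ℝ := (n.centralBinom : ℝ) / 4 ^ n

lemma tailProb_pos (n : ℕ) : 0 < tailProb n := by
  have := Nat.centralBinom_pos n
  unfold tailProb; positivity

lemma tailProb_succ (n : ℕ) : (2 * n + 2) * tailProb (n + 1) = (2 * n + 1) * tailProb n := by
  have h : ((n : ℝ) + 1) * (n + 1).centralBinom = 2 * (2 * n + 1) * n.centralBinom := by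
    exact_mod_cast Nat.succ_mul_centralBinom_succ n
  unfold tailProb
  rw [pow_succ]
  field_simp
  linarith

lemma gapProb_eq (n : ℕ) : gapProb n = tailProb n - tailProb (n + 1) := by
  have h1 := tailProb_succ n
  have h2 : ((n : ℝ) + 1) * catalan n = n.centralBinom := by
    exact_mod_cast succ_mul_catalan_eq_centralBinom n
  have h3 : (2 * n + 2) * gapProb n = tailProb n := by
    unfold gapProb tailProb
    rw [← h2]; field_simp
  have : (0 : ℝ) < 2 * n + 2 := by positivity
  apply mul_left_cancel₀ this.ne'
  linarith

lemma sum_gapProb_le (a b : ℕ) : ∑ n ∈ Ico a b, gapProb n ≤ tailProb a := by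
  rcases le_total b a with h | h
  · rw [Ico_eq_empty_of_le h, sum_empty]; exact (tailProb_pos a).le
  have : ∑ n ∈ Ico a b, gapProb n = tailProb a - tailProb b := by
    induction b, h using Nat.le_induction with
    | base => simp
    | succ b hb ih => rw [sum_Ico_succ_top hb, ih, gapProb_eq]; ring
  rw [this]
  linarith [tailProb_pos b]

/-- The left side is nonincreasing in `n`, because (2n+1)(2n+3) ≤ (2n+2)². -/
lemma tailProb_sq_mul_le (n : ℕ) : tailProb n ^ 2 * (2 * n + 1) ≤ 1 := by
  induction n with
  | zero => simp [tailProb]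
  | succ n ih =>
    have h1 := tailProb_succ n
    have hp : (0 : ℝ) < (2 * n + 2) ^ 2 := by positivity
    refine le_of_mul_le_mul_left ?_ hp
    calc ((2 : ℝ) * n + 2) ^ 2 * (tailProb (n + 1) ^ 2 * (2 * (n + 1 : ℕ) + 1))
        = ((2 * n + 2) * tailProb (n + 1)) ^ 2 * (2 * n + 3) := by push_cast; ring
      _ = (tailProb n ^ 2 * (2 * n + 1)) * ((2 * n + 1) * (2 * n + 3)) := by rw [h1]; ring
      _ ≤ 1 * ((2 * n + 1) * (2 * n + 3)) := by gcongr
      _ ≤ (2 * n + 2) ^ 2 * 1 := by nlinarith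

lemma one_le_tailProb_sq_mul (n : ℕ) (hn : 1 ≤ n) : 1 ≤ tailProb n ^ 2 * (4 * n) := by
  induction n, hn using Nat.le_induction with
  | base => simp [tailProb, Nat.centralBinom]; norm_num [Nat.choose]
  | succ n hn ih =>
    have h1 := tailProb_succ n
    have hp : (0 : ℝ) < (2 * n + 2) ^ 2 := by positivity
    refine le_of_mul_le_mul_left ?_ hp
    calc ((2 : ℝ) * n + 2) ^ 2 * 1 ≤ (tailProb n ^ 2 * (4 * n)) * (2 * n + 2) ^ 2 := by
          rw [mul_comm]; gcongr
      _ ≤ tailProb n ^ 2 * (2 * n + 1) ^ 2 * (4 * (n + 1)) := by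
          have : (4 * n : ℝ) * (2 * n + 2) ^ 2 ≤ (2 * n + 1) ^ 2 * (4 * (n + 1)) := by nlinarith
          nlinarith [mul_le_mul_of_nonneg_left this (sq_nonneg (tailProb n))]
      _ = ((2 * n + 2) * tailProb (n + 1)) ^ 2 * (4 * (n + 1)) := by rw [h1]; ring
      _ = (2 * n + 2) ^ 2 * (tailProb (n + 1) ^ 2 * (4 * (n + 1 : ℕ))) := by push_cast; ring

lemma tailProb_le_inv_sqrt (n : ℕ) : tailProb n ≤ 1 / √(n + 1 : ℝ) := by
  rw [le_div_iff₀ (by positivity)]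
  have h := tailProb_sq_mul_le n
  have hp := tailProb_pos n
  refine abs_le_of_sq_le_sq' ?_ zero_le_one |>.2
  rw [mul_pow, Real.sq_sqrt (by positivity)]
  nlinarith [sq_nonneg (tailProb n), Nat.cast_nonneg (α := ℝ) n,
    mul_nonneg (sq_nonneg (tailProb n)) (Nat.cast_nonneg (α := ℝ) n)]

lemma sum_tailProb (L : ℕ) : ∑ x ∈ range L, tailProb x = 2 * L * tailProb L := by
  induction L with
  | zero => simp
  | succ L ih => rw [sum_range_succ, ih]; push_cast; linarith [tailProb_succ L]

/-- The mean of a gap truncated at `L` is at most `2 √L`. -/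
lemma sum_gapProb_mul_min_le (L K : ℕ) :
    ∑ n ∈ range K, gapProb n * (min L (n + 1) : ℕ) ≤ 2 * √L := by
  -- The truncated value counts the `x < L` with `x ≤ n`, so exchanging sums turns the mean into a
  -- sum of tails.
  have h1 : ∀ n ∈ range K, gapProb n * (min L (n + 1) : ℕ) =
      ∑ x ∈ range L, if x ≤ n then gapProb n else 0 := by
    intro n _
    rw [← sum_filter, sum_const, nsmul_eq_mul, mul_comm]
    congr 2
    have : (range L).filter (fun x => x ≤ n) = range (min L (n + 1)) := by
      ext x; simp
    rw [this, card_range]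
  rw [sum_congr rfl h1, sum_comm]
  calc ∑ x ∈ range L, ∑ n ∈ range K, (if x ≤ n then gapProb n else 0)
      ≤ ∑ x ∈ range L, tailProb x := by
        refine sum_le_sum fun x _ => ?_
        rw [← sum_filter]
        refine le_trans (le_of_eq (sum_congr ?_ fun _ _ => rfl)) (sum_gapProb_le x K)
        ext n; simp [and_comm]
    _ = 2 * L * tailProb L := sum_tailProb L
    _ ≤ 2 * L * (1 / √(L + 1 : ℝ)) := by gcongr; exact tailProb_le_inv_sqrt L
    _ ≤ 2 * √L := by
        have h2 : √(L : ℝ) ≤ √(L + 1 : ℝ) := Real.sqrt_le_sqrt (by linarith)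
        have h3 : √(L : ℝ) * √L = L := Real.mul_self_sqrt (by positivity)
        rw [mul_one_div, div_le_iff₀ (by positivity)]
        nlinarith [Real.sqrt_nonneg (L : ℝ)]

/-! ### Lower bound for the normalising constant -/

lemma four_pow_le_centralBinom (n : ℕ) (hn : 1 ≤ n) :
    (4 : ℝ) ^ n ≤ 2 * √n * n.centralBinom := by
  have h := one_le_tailProb_sq_mul n hn
  have h1 : 1 ≤ tailProb n * (2 * √n) := by
    refine abs_le_of_sq_le_sq' (a := 1) ?_ (by have := tailProb_pos n; positivity) |>.2
    rw [mul_pow, mul_pow, Real.sq_sqrt (by positivity)]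
    linarith
  unfold tailProb at h1
  rw [div_mul_eq_mul_div, le_div_iff₀ (by positivity)] at h1
  linarith

lemma two_pow_le_choose_half (N : ℕ) (hN : 1 ≤ N) :
    (2 : ℝ) ^ N ≤ 2 * √N * N.choose (N / 2) := by
  rcases Nat.even_or_odd' N with ⟨h, rfl | rfl⟩
  · have := four_pow_le_centralBinom h (by omega)
    rw [Nat.mul_div_cancel_left _ two_pos, ← Nat.centralBinom_eq_two_mul_choose, pow_mul]
    norm_num at this ⊢
    refine this.trans ?_
    have h1 : √(h : ℝ) ≤ √2 * √h := by
      have : 1 ≤ √2 := Real.one_le_sqrt.2 (by norm_num)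
      nlinarith [Real.sqrt_nonneg (h : ℝ)]
    gcongr
  · have h1 := four_pow_le_centralBinom (h + 1) (by omega)
    have h2 : ((h + 1).centralBinom : ℝ) = 2 * (2 * h + 1).choose ((2 * h + 1) / 2) := by
      rw [show (2 * h + 1) / 2 = h by omega]
      have e : (h + 1).centralBinom = 2 * (2 * h + 1).choose h := by
        rw [Nat.centralBinom_eq_two_mul_choose, show 2 * (h + 1) = (2 * h + 1) + 1 by ring,
          Nat.choose_succ_succ, Nat.choose_symm_half, ← two_mul]
      exact_mod_cast e
    have h3 : √((h + 1 : ℕ) : ℝ) ≤ √((2 * h + 1 : ℕ) : ℝ) :=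
      Real.sqrt_le_sqrt (by exact_mod_cast (by omega : h + 1 ≤ 2 * h + 1))
    have h4 : (4 : ℝ) ^ (h + 1) = 2 * 2 ^ (2 * h + 1) := by
      rw [show (4 : ℝ) = 2 ^ 2 by norm_num, ← pow_mul, ← pow_succ']; congr 1
    rw [h2, h4] at h1
    have h5 : 2 * √((h + 1 : ℕ) : ℝ) * (2 * ((2 * h + 1).choose ((2 * h + 1) / 2) : ℝ)) ≤
      2 * √((2 * h + 1 : ℕ) : ℝ) * (2 * ((2 * h + 1).choose ((2 * h + 1) / 2) : ℝ)) := by gcongr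
    linarith

lemma choose_mul_pow_le (n r k : ℕ) (hk : 2 * k ≤ r) :
    ((2 * n + r).choose (n + k) : ℝ) * n ^ k ≤ (2 * n + r).choose n * ((n : ℝ) + r) ^ k := by
  induction k with
  | zero => simp
  | succ k ih =>
    have ih := ih (by omega)
    have h := Nat.choose_succ_right_eq (2 * n + r) (n + k)
    have h1 : ((2 * n + r).choose (n + (k + 1)) : ℝ) * (n + k + 1) =
        (2 * n + r).choose (n + k) * ((n : ℝ) + r - k) := by
      have e : ((2 * n + r - (n + k) : ℕ) : ℝ) = (n : ℝ) + r - k := by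
        rw [Nat.cast_sub (by omega)]; push_cast; ring
      rw [← e]; exact_mod_cast h
    have hk0 : (0 : ℝ) ≤ k := Nat.cast_nonneg k
    have h2 : ((2 * n + r).choose (n + (k + 1)) : ℝ) * n ≤
        (2 * n + r).choose (n + k) * ((n : ℝ) + r) := by
      have a1 : ((2 * n + r).choose (n + (k + 1)) : ℝ) * n ≤
        (2 * n + r).choose (n + (k + 1)) * (n + k + 1) := by gcongr; linarith
      have a2 : ((2 * n + r).choose (n + k) : ℝ) * ((n : ℝ) + r - k) ≤
        (2 * n + r).choose (n + k) * ((n : ℝ) + r) := by gcongr; linarith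
      linarith
    calc ((2 * n + r).choose (n + (k + 1)) : ℝ) * n ^ (k + 1)
        = (((2 * n + r).choose (n + (k + 1)) : ℝ) * n) * n ^ k := by ring
      _ ≤ ((2 * n + r).choose (n + k) * ((n : ℝ) + r)) * n ^ k := by gcongr
      _ = (((2 * n + r).choose (n + k) : ℝ) * n ^ k) * ((n : ℝ) + r) := by ring
      _ ≤ ((2 * n + r).choose n * ((n : ℝ) + r) ^ k) * ((n : ℝ) + r) := by gcongr
      _ = _ := by ring

/-- About `r / 2` steps lead from `n` to the centre, and each raises the binomial by a factor at
most `1 + r / n ≤ exp (r / n)`. -/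
lemma choose_half_le (n r : ℕ) (hn : 0 < n) :
    ((2 * n + r).choose ((2 * n + r) / 2) : ℝ) ≤
      (2 * n + r).choose n * Real.exp ((r : ℝ) ^ 2 / n) := by
  have h := choose_mul_pow_le n r (r / 2) (by omega)
  have hn' : (0 : ℝ) < n := by exact_mod_cast hn
  rw [show (2 * n + r) / 2 = n + r / 2 by omega]
  have h1 : ((n : ℝ) + r) ^ (r / 2) = n ^ (r / 2) * (1 + r / n) ^ (r / 2) := by
    rw [← mul_pow]; congr 1; field_simp
  rw [h1] at h
  have h2 : (1 + (r : ℝ) / n) ^ (r / 2) ≤ Real.exp ((r : ℝ) ^ 2 / n) := by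
    calc (1 + (r : ℝ) / n) ^ (r / 2) ≤ (1 + (r : ℝ) / n) ^ r :=
          pow_le_pow_right₀ (le_add_of_nonneg_right (by positivity)) (Nat.div_le_self _ _)
      _ ≤ Real.exp (r / n) ^ r := by
          gcongr
          have := Real.add_one_le_exp ((r : ℝ) / n); linarith
      _ = Real.exp ((r : ℝ) ^ 2 / n) := by
          rw [← Real.exp_nat_mul]; congr 1; field_simp
  have h3 : ((2 * n + r).choose (n + r / 2) : ℝ) ≤
      (2 * n + r).choose n * (1 + (r : ℝ) / n) ^ (r / 2) := by
    refine le_of_mul_le_mul_right ?_ (pow_pos hn' (r / 2))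
    linarith
  refine h3.trans ?_
  gcongr

/-- Lower bound for the normalising constant in the diffusive regime. -/
lemma exists_le_sumProb (α β : ℝ) (hα : 0 < α) (hβ : 0 < β) :
    ∃ c : ℝ, 0 < c ∧ ∀ m U : ℕ, 2 ≤ m → 2 ≤ α * m → α * (m : ℝ) ^ 2 ≤ U → (U : ℝ) ≤ β * (m : ℝ) ^ 2 →
      m < U ∧ c / (m : ℝ) ^ 2 ≤ sumProb (m + 1) (U - m) := by
  -- With `N = 2 * n + m + 1 ≤ 2 * β * m ^ 2`, the central binomial is at least `2 ^ N / (2 * √N)`,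
  -- moving from the centre to `n` costs at most `exp (8 / α)`, and the hitting time formula
  -- supplies the factor `(m + 1) / N`.
  refine ⟨Real.exp (-(8 / α)) / (4 * β * √(2 * β)), by positivity, fun m U hm hαm h1 h2 => ?_⟩
  have hm' : (2 : ℝ) ≤ m := by exact_mod_cast hm
  have hmU' : (m : ℝ) < U := by nlinarith
  have hmU : m < U := by exact_mod_cast hmU'
  refine ⟨hmU, ?_⟩
  obtain ⟨n, rfl⟩ : ∃ n, U = m + n := ⟨U - m, by omega⟩
  rw [Nat.add_sub_cancel_left]
  push_cast at h1 h2 hmU'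
  have hn : 0 < n := by omega
  have hn' : (0 : ℝ) < n := by exact_mod_cast hn
  have hnα : α / 2 * (m : ℝ) ^ 2 ≤ n := by nlinarith
  set N := 2 * n + (m + 1) with hN
  have hNle : (N : ℝ) ≤ 2 * β * (m : ℝ) ^ 2 := by rw [hN]; push_cast; linarith
  have hNpos : (0 : ℝ) < N := by rw [hN]; positivity
  have e1 : (((m + 1 : ℕ) : ℝ)) ^ 2 / n ≤ 8 / α := by
    rw [div_le_div_iff₀ hn' hα]; push_cast
    nlinarith
  have e2 := two_pow_le_choose_half N (by omega)
  have e3 := choose_half_le n (m + 1) hn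
  rw [← hN] at e3
  have e4 := mul_sumProb (m + 1) n
  rw [← hN] at e4
  have e5 : (2 : ℝ) ^ N ≤ 2 * √N * (N.choose n * Real.exp (8 / α)) := by
    refine e2.trans ?_
    gcongr
    refine e3.trans ?_
    gcongr
  have e6 : √(N : ℝ) ≤ √(2 * β) * m := by
    rw [← Real.sqrt_sq (Nat.cast_nonneg m : (0 : ℝ) ≤ m), ← Real.sqrt_mul (by positivity)]
    exact Real.sqrt_le_sqrt hNle
  have e7 : (2 : ℝ) ^ N * (m + 1) ≤
      2 * √N * (N * (sumProb (m + 1) n * 2 ^ N) * Real.exp (8 / α)) := by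
    rw [e4]; push_cast
    calc (2 : ℝ) ^ N * (m + 1) ≤ 2 * √N * (N.choose n * Real.exp (8 / α)) * (m + 1) := by gcongr
      _ = _ := by ring
  have hp := sumProb_nonneg (m + 1) n
  have e8 : ((m : ℝ) + 1) ≤ 2 * √N * N * sumProb (m + 1) n * Real.exp (8 / α) := by
    refine le_of_mul_le_mul_left ?_ (by positivity : (0 : ℝ) < 2 ^ N)
    linarith
  have e9 : (m : ℝ) ≤ 2 * (√(2 * β) * m) * (2 * β * (m : ℝ) ^ 2) * sumProb (m + 1) n *
      Real.exp (8 / α) := by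
    calc (m : ℝ) ≤ m + 1 := by linarith
      _ ≤ _ := e8
      _ ≤ _ := by gcongr
  rw [Real.exp_neg, div_le_iff₀ (by positivity), div_le_iff₀ (by positivity),
    inv_le_iff_one_le_mul₀ (by positivity)]
  refine le_of_mul_le_mul_left ?_ (by linarith : (0 : ℝ) < m)
  rw [mul_one]
  refine e9.trans_eq ?_
  ring

/-! ### The Catalan law as a conditioned law of gaps -/

section points

variable {U m : ℕ} {T : Finset ℕ}

lemma mem_subsets : T ∈ subsets U m ↔ (∀ x ∈ T, 1 ≤ x ∧ x ≤ U) ∧ T.card = m := by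
  simp [subsets, mem_powersetCard, subset_iff]

lemma pt_zero : pt U T 0 = 0 := by simp [pt]

lemma pt_succ_of_lt {j : ℕ} (hj : j < T.card) :
    pt U T (j + 1) = (T.sort (· ≤ ·))[j]'(by simpa using hj) := by
  have : j < (T.sort (· ≤ ·)).length := by simpa using hj
  rw [pt, List.getD_cons_succ, List.getD_eq_getElem _ _ (by simp; omega),
    List.getElem_append_left this]

lemma pt_card_succ : pt U T (T.card + 1) = U + 1 := by
  rw [pt, List.getD_cons_succ, List.getD_eq_getElem _ _ (by simp),
    List.getElem_append_right (by simp)]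
  simp

lemma pt_lt_pt (hT : T ∈ subsets U m) {i j : ℕ} (hij : i < j) (hj : j ≤ m + 1) :
    pt U T i < pt U T j := by
  obtain ⟨h1, h2⟩ := mem_subsets.1 hT
  have hl : (0 :: (T.sort (· ≤ ·) ++ [U + 1])).length = m + 2 := by simp [h2]
  have hp : (0 :: (T.sort (· ≤ ·) ++ [U + 1])).Pairwise (· < ·) := by
    rw [List.pairwise_cons, List.pairwise_append]
    refine ⟨fun a ha => ?_, T.sortedLT_sort.pairwise, by simp, fun a ha b hb => ?_⟩
    · simp only [List.mem_append, mem_sort, List.mem_singleton] at ha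
      rcases ha with ha | rfl
      · exact (h1 a ha).1
      · omega
    · simp only [mem_sort, List.mem_singleton] at ha hb
      have := (h1 a ha).2
      omega
  rw [pt, pt, List.getD_eq_getElem _ _ (by omega), List.getD_eq_getElem _ _ (by omega)]
  exact List.pairwise_iff_getElem.1 hp _ _ _ _ hij

lemma pt_le_pt (hT : T ∈ subsets U m) {i j : ℕ} (hij : i ≤ j) (hj : j ≤ m + 1) :
    pt U T i ≤ pt U T j := by
  rcases hij.eq_or_lt with rfl | h
  · exact le_rfl
  · exact (pt_lt_pt hT h hj).le

lemma mem_iff_exists_pt (hT : T ∈ subsets U m) {x : ℕ} :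
    x ∈ T ↔ ∃ j < m, pt U T (j + 1) = x := by
  obtain ⟨_, rfl⟩ := mem_subsets.1 hT
  rw [← mem_sort (· ≤ ·), List.mem_iff_getElem]
  constructor
  · rintro ⟨j, hj, rfl⟩
    have hj' : j < T.card := by simpa using hj
    exact ⟨j, hj', pt_succ_of_lt hj'⟩
  · rintro ⟨j, hj, rfl⟩
    exact ⟨j, by simpa using hj, (pt_succ_of_lt hj).symm⟩

/-- The gap vector: the `j`-th entry is `s_{j+1} - s_j - 1`. -/
noncomputable def gaps (U m : ℕ) (T : Finset ℕ) : ℕ →₀ ℕ :=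
  Finsupp.onFinset (range (m + 1))
    (fun j => if j < m + 1 then pt U T (j + 1) - pt U T j - 1 else 0) (by intro j; simp; tauto)

lemma gaps_apply {j : ℕ} (hj : j < m + 1) : gaps U m T j = pt U T (j + 1) - pt U T j - 1 := by
  simp only [gaps, Finsupp.onFinset_apply, if_pos hj]

lemma pt_succ_eq (hT : T ∈ subsets U m) {j : ℕ} (hj : j < m + 1) :
    pt U T (j + 1) = pt U T j + (gaps U m T j + 1) := by
  rw [gaps_apply hj]
  have := pt_lt_pt hT (Nat.lt_add_one j) hj
  omega

lemma pt_eq_sum (hT : T ∈ subsets U m) {j : ℕ} (hj : j ≤ m + 1) :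
    pt U T j = ∑ i ∈ range j, (gaps U m T i + 1) := by
  induction j with
  | zero => simp [pt_zero]
  | succ j ih => rw [sum_range_succ, ← ih (by omega), pt_succ_eq hT (by omega)]

lemma gaps_mem (hT : T ∈ subsets U m) : gaps U m T ∈ finsuppAntidiag (range (m + 1)) (U - m) := by
  rw [mem_finsuppAntidiag]
  refine ⟨?_, Finsupp.support_onFinset_subset⟩
  have h := pt_eq_sum hT le_rfl
  rw [sum_add_distrib] at h
  have h2 : pt U T (m + 1) = U + 1 := by
    rw [← (mem_subsets.1 hT).2]; exact pt_card_succ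
  simp only [sum_const, card_range, smul_eq_mul, mul_one] at h
  change ∑ i ∈ range (m + 1), gaps U m T i = _
  omega

lemma gaps_injOn : Set.InjOn (gaps U m) (subsets U m : Set (Finset ℕ)) := by
  intro T hT T' hT' h
  rw [mem_coe] at hT hT'
  ext x
  rw [mem_iff_exists_pt hT, mem_iff_exists_pt hT']
  refine exists_congr fun j => and_congr_right fun hj => ?_
  rw [pt_eq_sum hT (by omega), pt_eq_sum hT' (by omega), h]

lemma image_gaps (hm : m ≤ U) :
    (subsets U m).image (gaps U m) = finsuppAntidiag (range (m + 1)) (U - m) := by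
  refine eq_of_subset_of_card_le (fun x hx => ?_) ?_
  · obtain ⟨T, hT, rfl⟩ := mem_image.1 hx
    exact gaps_mem hT
  · rw [card_image_of_injOn gaps_injOn, card_finsuppAntidiag_nat_eq_choose, subsets,
      card_powersetCard]
    simp only [card_range, Nat.card_Icc]
    rw [show m + 1 + (U - m) - 1 = U by omega, Nat.add_sub_cancel, Nat.choose_symm hm]

lemma sum_subsets_gaps (hm : m ≤ U) (F : (ℕ →₀ ℕ) → ℝ) :
    ∑ T ∈ subsets U m, F (gaps U m T) = ∑ x ∈ finsuppAntidiag (range (m + 1)) (U - m), F x := by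
  rw [← image_gaps hm, sum_image gaps_injOn]

/-- The prefactor is the same for every `T`, since the gaps always sum to `U - m`; it cancels in the
normalised law. -/
lemma weight_eq (hT : T ∈ subsets U m) :
    (weight U T : ℝ) = (2 ^ (m + 1) * 4 ^ (U - m)) * ∏ j ∈ range (m + 1), gapProb (gaps U m T j) := by
  have h2 := (mem_subsets.1 hT).2
  have h3 : ∑ i ∈ range (m + 1), gaps U m T i = U - m := (mem_finsuppAntidiag.1 (gaps_mem hT)).1
  have h4 : ∏ j ∈ range (m + 1), gapProb (gaps U m T j) =
      (∏ j ∈ range (m + 1), (catalan (gaps U m T j) : ℝ)) / (2 ^ (m + 1) * 4 ^ (U - m)) := by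
    simp only [gapProb]
    rw [prod_div_distrib, prod_mul_distrib, prod_pow_eq_pow_sum, h3]
    simp
  rw [h4, mul_div_cancel₀ _ (by positivity), weight, h2]
  push_cast
  refine prod_congr rfl fun j hj => ?_
  rw [gaps_apply (mem_range.1 hj)]

lemma M_eq (hm : m ≤ U) : (M U m : ℝ) = (2 ^ (m + 1) * 4 ^ (U - m)) * sumProb (m + 1) (U - m) := by
  rw [M, sumProb, PowerSeries.coeff_pow, Nat.cast_sum, sum_congr rfl fun T hT => weight_eq hT,
    sum_subsets_gaps hm (fun x => (2 ^ (m + 1) * 4 ^ (U - m)) * ∏ j ∈ range (m + 1), gapProb (x j)),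
    ← mul_sum]
  simp [gapSeries]

lemma setProb_eq (hT : T ∈ subsets U m) :
    setProb U m T = (∏ j ∈ range (m + 1), gapProb (gaps U m T j)) / sumProb (m + 1) (U - m) := by
  have hm : m ≤ U := by
    have := (mem_powersetCard.1 hT)
    have h := card_le_card this.1
    rw [this.2, Nat.card_Icc] at h; omega
  rw [setProb, if_pos hT, weight_eq hT, M_eq hm, mul_div_mul_left _ _ (by positivity)]

lemma setProb_nonneg : 0 ≤ setProb U m T := by
  unfold setProb; split_ifs <;> positivity

end points

/-! ### Comparison with independent gaps -/

lemma sum_setProb {U m : ℕ} (hM : 0 < M U m) : ∑ T ∈ subsets U m, setProb U m T = 1 := by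
  have hM' : (M U m : ℝ) ≠ 0 := by exact_mod_cast hM.ne'
  have h : ∀ T ∈ subsets U m, setProb U m T = (weight U T : ℝ) / (M U m : ℝ) :=
    fun T hT => if_pos hT
  rw [sum_congr rfl h, ← sum_div, ← Nat.cast_sum]
  exact div_self hM'

/-- Summing out all gaps except the `i`-th and the `j`-th leaves an atom of a sum of `m - 1` gaps,
which by hypothesis exceeds the normalising atom by at most the factor `K`. -/
lemma sum_setProb_mul_le {U m : ℕ} {K : ℝ} (hmU : m ≤ U)
    (hK : ∀ n, sumProb (m - 1) n ≤ K * sumProb (m + 1) (U - m))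
    (hp : 0 < sumProb (m + 1) (U - m))
    {i j : ℕ} (hij : i ≠ j) (hi : i < m + 1) (hj : j < m + 1) (φ ψ : ℕ → ℝ)
    (hφ : ∀ n, 0 ≤ φ n) (hψ : ∀ n, 0 ≤ ψ n) :
    ∑ T ∈ subsets U m, setProb U m T * (φ (gaps U m T i) * ψ (gaps U m T j)) ≤
      K * ((∑ n ∈ range (U + 1), gapProb n * φ n) * ∑ n ∈ range (U + 1), gapProb n * ψ n) := by
  classical
  set n := U - m with hn
  let f : ℕ → PowerSeries ℝ := fun k =>
    if k = i then PowerSeries.mk fun n => gapProb n * φ n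
    else if k = j then PowerSeries.mk fun n => gapProb n * ψ n else gapSeries
  have h1 : ∑ T ∈ subsets U m, setProb U m T * (φ (gaps U m T i) * ψ (gaps U m T j)) =
      (PowerSeries.coeff n (∏ k ∈ range (m + 1), f k)) / sumProb (m + 1) n := by
    rw [PowerSeries.coeff_prod, sum_div, ← sum_subsets_gaps hmU
      (fun l => (∏ k ∈ range (m + 1), PowerSeries.coeff (l k) (f k)) / sumProb (m + 1) n)]
    refine sum_congr rfl fun T hT => ?_
    rw [setProb_eq hT, div_mul_eq_mul_div]
    congr 1
    have hi' : i ∈ range (m + 1) := mem_range.2 hi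
    have hj' : j ∈ (range (m + 1)).erase i := mem_erase.2 ⟨hij.symm, mem_range.2 hj⟩
    rw [← mul_prod_erase _ _ hi', ← mul_prod_erase _ _ hj',
      ← mul_prod_erase (range (m + 1)) (fun k => PowerSeries.coeff (gaps U m T k) (f k)) hi',
      ← mul_prod_erase _ (fun k => PowerSeries.coeff (gaps U m T k) (f k)) hj']
    have e : ∏ x ∈ ((range (m + 1)).erase i).erase j, PowerSeries.coeff (gaps U m T x) (f x) =
        ∏ x ∈ ((range (m + 1)).erase i).erase j, gapProb (gaps U m T x) := by
      refine prod_congr rfl fun x hx => ?_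
      simp only [mem_erase] at hx
      simp [f, hx.1, hx.2.1, gapSeries]
    rw [e]
    simp only [f, if_true, if_neg hij.symm, PowerSeries.coeff_mk]
    ring
  have h2 : ∏ k ∈ range (m + 1), f k = (PowerSeries.mk fun n => gapProb n * φ n) *
      ((PowerSeries.mk fun n => gapProb n * ψ n) * gapSeries ^ (m - 1)) := by
    have hi' : i ∈ range (m + 1) := mem_range.2 hi
    have hj' : j ∈ (range (m + 1)).erase i := mem_erase.2 ⟨hij.symm, mem_range.2 hj⟩
    rw [← mul_prod_erase _ _ hi', ← mul_prod_erase _ _ hj']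
    have e : ∏ x ∈ ((range (m + 1)).erase i).erase j, f x = gapSeries ^ (m - 1) := by
      rw [prod_congr rfl (g := fun _ => gapSeries), prod_const, card_erase_of_mem hj',
        card_erase_of_mem hi', card_range]
      · congr 1
      · intro x hx
        simp only [mem_erase] at hx
        simp [f, hx.1, hx.2.1]
    rw [e]
    simp only [f, if_true, if_neg hij.symm]
  rw [h1, div_le_iff₀ hp, h2, PowerSeries.coeff_mul]
  have hA : ∀ a, 0 ≤ gapProb a * φ a := fun a => mul_nonneg (gapProb_nonneg a) (hφ a)
  have hB : ∀ a, 0 ≤ gapProb a * ψ a := fun a => mul_nonneg (gapProb_nonneg a) (hψ a)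
  -- Convolving a nonnegative sequence with one bounded by `R` gives at most `R` times its mass.
  -- This is applied once for each of the two distinguished gaps.
  have key : ∀ (g : ℕ → ℝ) (V : PowerSeries ℝ) (R : ℝ) (k : ℕ), k ≤ U → (∀ a, 0 ≤ g a) → 0 ≤ R →
      (∀ a ≤ k, PowerSeries.coeff a V ≤ R) →
      ∑ x ∈ antidiagonal k, PowerSeries.coeff x.1 (PowerSeries.mk g) * PowerSeries.coeff x.2 V ≤
        (∑ a ∈ range (U + 1), g a) * R := by
    intro g V R k hk hg hR hV
    rw [Nat.sum_antidiagonal_eq_sum_range_succ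
      (fun a b => PowerSeries.coeff a (PowerSeries.mk g) * PowerSeries.coeff b V), sum_mul]
    refine (sum_le_sum fun a ha => ?_).trans (sum_le_sum_of_subset_of_nonneg
      (range_subset_range.2 (by omega)) fun a _ _ => mul_nonneg (hg a) hR)
    rw [PowerSeries.coeff_mk]
    exact mul_le_mul_of_nonneg_left (hV _ (Nat.sub_le _ _)) (hg a)
  have hR : 0 ≤ K * sumProb (m + 1) n := (sumProb_nonneg _ _).trans (hK 0)
  refine (key _ _ ((∑ n ∈ range (U + 1), gapProb n * ψ n) * (K * sumProb (m + 1) n)) n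
    (Nat.sub_le _ _) hA (mul_nonneg (sum_nonneg fun a _ => hB a) hR) fun a ha => ?_).trans_eq
    (by ring)
  rw [PowerSeries.coeff_mul]
  exact key _ _ _ a (ha.trans (Nat.sub_le _ _)) hB hR fun b _ => hK b

lemma sum_gapProb_range_le_one (K : ℕ) : ∑ n ∈ range K, gapProb n ≤ 1 := by
  have := sum_gapProb_le 0 K
  simpa [tailProb] using this

/-- The parameters for which the Catalan law behaves like a law of independent gaps, up to the
constant `K`. -/
structure Regular (K : ℝ) (U m : ℕ) : Prop where
  two_le : 2 ≤ m
  le : m ≤ U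
  pos : 0 < sumProb (m + 1) (U - m)
  sumProb_le : ∀ n, sumProb (m - 1) n ≤ K * sumProb (m + 1) (U - m)

lemma Regular.const_nonneg {K : ℝ} {U m : ℕ} (h : Regular K U m) : 0 ≤ K :=
  nonneg_of_mul_nonneg_left ((sumProb_nonneg _ _).trans (h.sumProb_le 0)) h.pos

lemma Regular.M_pos {K : ℝ} {U m : ℕ} (h : Regular K U m) : 0 < M U m := by
  have := M_eq h.le
  have h2 : (0 : ℝ) < M U m := by rw [this]; have := h.pos; positivity
  exact_mod_cast h2

lemma Regular.sum_mul_le {K : ℝ} {U m : ℕ} (h : Regular K U m) {i : ℕ} (hi : i < m + 1)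
    (φ : ℕ → ℝ) (hφ : ∀ n, 0 ≤ φ n) :
    ∑ T ∈ subsets U m, setProb U m T * φ (gaps U m T i) ≤
      K * ∑ n ∈ range (U + 1), gapProb n * φ n := by
  have h2 := h.two_le
  obtain ⟨j, hj, hij⟩ : ∃ j < m + 1, i ≠ j := by
    rcases i with _ | i
    · exact ⟨1, by omega, by omega⟩
    · exact ⟨0, by omega, by omega⟩
  have := sum_setProb_mul_le h.le h.sumProb_le h.pos hij hi hj φ (fun _ => 1) hφ
    (fun _ => zero_le_one)
  simp only [mul_one] at this
  refine this.trans (mul_le_mul_of_nonneg_left ?_ h.const_nonneg)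
  refine mul_le_of_le_one_right (sum_nonneg fun n _ => mul_nonneg (gapProb_nonneg n) (hφ n)) ?_
  exact sum_gapProb_range_le_one _

/-- The mean of a truncated gap. -/
lemma Regular.sum_min_le {K : ℝ} {U m : ℕ} (h : Regular K U m) (L : ℕ) {i : ℕ} (hi : i < m + 1) :
    ∑ T ∈ subsets U m, setProb U m T * (min L (gaps U m T i + 1) : ℕ) ≤ K * (2 * √L) :=
  (h.sum_mul_le hi (fun n => (min L (n + 1) : ℕ)) fun _ => Nat.cast_nonneg _).trans
    (mul_le_mul_of_nonneg_left (sum_gapProb_mul_min_le L _) h.const_nonneg)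

/-- The mean product of two truncated gaps. -/
lemma Regular.sum_min_mul_min_le {K : ℝ} {U m : ℕ} (h : Regular K U m) (L : ℕ) {i j : ℕ}
    (hij : i ≠ j) (hi : i < m + 1) (hj : j < m + 1) :
    ∑ T ∈ subsets U m, setProb U m T *
      ((min L (gaps U m T i + 1) : ℕ) * (min L (gaps U m T j + 1) : ℕ)) ≤ K * (4 * L) := by
  refine (sum_setProb_mul_le h.le h.sumProb_le h.pos hij hi hj
    (fun n => (min L (n + 1) : ℕ)) (fun n => (min L (n + 1) : ℕ))
    (fun _ => Nat.cast_nonneg _) fun _ => Nat.cast_nonneg _).trans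
    (mul_le_mul_of_nonneg_left ?_ h.const_nonneg)
  have h1 := sum_gapProb_mul_min_le L (U + 1)
  have h0 : 0 ≤ ∑ n ∈ range (U + 1), gapProb n * (min L (n + 1) : ℕ) :=
    sum_nonneg fun n _ => mul_nonneg (gapProb_nonneg n) (Nat.cast_nonneg _)
  calc _ ≤ (2 * √L) * (2 * √L) := mul_le_mul h1 h1 h0 (by positivity)
    _ = 4 * (√L * √L) := by ring
    _ = 4 * L := by rw [Real.mul_self_sqrt (by positivity)]

/-- The probability of a large gap. -/
lemma Regular.sum_ite_le {K : ℝ} {U m : ℕ} (h : Regular K U m) (x : ℕ) (hx : 0 < x) {i : ℕ}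
    (hi : i < m + 1) :
    ∑ T ∈ subsets U m, setProb U m T * (if x ≤ gaps U m T i + 1 then 1 else 0) ≤
      K * (1 / √x) := by
  refine (h.sum_mul_le hi (fun n => if x ≤ n + 1 then 1 else 0)
    fun _ => by split_ifs <;> norm_num).trans (mul_le_mul_of_nonneg_left ?_ h.const_nonneg)
  obtain ⟨y, rfl⟩ : ∃ y, x = y + 1 := ⟨x - 1, by omega⟩
  have := (sum_gapProb_le y (U + 1)).trans (tailProb_le_inv_sqrt y)
  push_cast
  refine le_trans (le_of_eq ?_) this
  simp only [mul_ite, mul_one, mul_zero]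
  rw [← sum_filter]
  refine sum_congr ?_ fun _ _ => rfl
  ext n; simp [and_comm]

lemma exists_regular (α β : ℝ) (hα : 0 < α) (hβ : 0 < β) :
    ∃ K : ℝ, 0 < K ∧ ∀ m U : ℕ, 2 ≤ m → 2 ≤ α * m → α * (m : ℝ) ^ 2 ≤ U →
      (U : ℝ) ≤ β * (m : ℝ) ^ 2 → Regular K U m := by
  obtain ⟨c, hc, H⟩ := exists_le_sumProb α β hα hβ
  refine ⟨64 / c, by positivity, fun m U h1 h2 h3 h4 => ?_⟩
  obtain ⟨h5, h6⟩ := H m U h1 h2 h3 h4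
  have hm : (2 : ℝ) ≤ m := by exact_mod_cast h1
  refine ⟨h1, h5.le, lt_of_lt_of_le (by positivity) h6, fun n => ?_⟩
  refine (sumProb_le (by omega : 0 < m - 1) n).trans ?_
  calc 16 / ((m - 1 : ℕ) : ℝ) ^ 2 ≤ 64 / (m : ℝ) ^ 2 := by
        rw [Nat.cast_sub (by omega), Nat.cast_one,
          div_le_div_iff₀ (pow_pos (by linarith) 2) (by positivity)]
        nlinarith
    _ = 64 / c * (c / (m : ℝ) ^ 2) := by field_simp
    _ ≤ _ := by gcongr

/-! ### Self-delimiting codes -/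

/-- A self-delimiting encoding of bit strings. -/
def encBits : List Bool → List Bool
  | [] => [false]
  | b :: l => true :: b :: encBits l

lemma length_encBits (l : List Bool) : (encBits l).length = 2 * l.length + 1 := by
  induction l with
  | nil => rfl
  | cons b l ih => simp only [encBits, List.length_cons, ih]; ring

lemma encBits_append_inj : ∀ {l l' x y : List Bool},
    encBits l ++ x = encBits l' ++ y → l = l' ∧ x = y
  | [], [], x, y, h => by simpa [encBits] using h
  | [], b :: l, x, y, h => by simp [encBits] at h
  | b :: l, [], x, y, h => by simp [encBits] at h
  | b :: l, b' :: l', x, y, h => by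
    simp only [encBits, List.cons_append, List.cons.injEq, true_and] at h
    obtain ⟨rfl, h⟩ := h
    obtain ⟨rfl, rfl⟩ := encBits_append_inj h
    exact ⟨rfl, rfl⟩

/-- A self-delimiting encoding of lists of natural numbers. -/
def encList : List ℕ → List Bool
  | [] => [false]
  | n :: l => true :: (encBits n.bits ++ encList l)

lemma bits_inj {a b : ℕ} (h : a.bits = b.bits) : a = b := by
  refine Nat.eq_of_testBit_eq fun i => ?_
  rw [Nat.testBit_eq_inth, Nat.testBit_eq_inth, h]

lemma encList_append_inj : ∀ {l l' : List ℕ} {x y : List Bool},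
    encList l ++ x = encList l' ++ y → l = l' ∧ x = y
  | [], [], x, y, h => by simpa [encList] using h
  | [], b :: l, x, y, h => by simp [encList] at h
  | b :: l, [], x, y, h => by simp [encList] at h
  | b :: l, b' :: l', x, y, h => by
    simp only [encList, List.cons_append, List.cons.injEq, true_and, List.append_assoc] at h
    obtain ⟨h1, h⟩ := encBits_append_inj h
    obtain ⟨rfl, rfl⟩ := encList_append_inj h
    exact ⟨by rw [bits_inj h1], rfl⟩

/-- The number of bits spent by `encList`, apart from the final one. -/
def cost (l : List ℕ) : ℕ := (l.map fun n => 2 * n.size + 2).sum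

lemma length_encList (l : List ℕ) : (encList l).length = cost l + 1 := by
  induction l with
  | nil => rfl
  | cons n l ih =>
    simp only [encList, List.length_cons, List.length_append, length_encBits, ih, cost,
      List.map_cons, List.sum_cons, Nat.size_eq_bits_len]
    ring

/-! ### Describing a list relative to a known subset -/

/-- The instructions that complete the set `D` to the strictly increasing list `l`: each entry
outside `D` is described by the number of entries in `D` since the previous one, and by its
distance from its predecessor. The argument `p` is the predecessor of the head of `l`,
and `a` is the current number of skipped entries. -/
def describe (D : Finset ℕ) : ℕ → ℕ → List ℕ → List ℕ
  | _, _, [] => []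
  | p, a, j :: l => if j ∈ D then describe D j (a + 1) l else a :: (j - p) :: describe D j 0 l

/-- The counter only grows until it is emitted. An entry skipped now therefore yields a next count
of at least `a + 1`, which cannot be confused with emitting `a`. -/
lemma le_of_describe_eq_cons {D : Finset ℕ} {x : ℕ} {r : List ℕ} :
    ∀ {l : List ℕ} {p a : ℕ}, describe D p a l = x :: r → a ≤ x
  | [], p, a, h => by simp [describe] at h
  | j :: l, p, a, h => by
    rw [describe] at h
    split_ifs at h with hj
    · exact (Nat.le_succ a).trans (le_of_describe_eq_cons h)
    · simp only [List.cons.injEq] at h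
      exact h.1.le

lemma describe_inj {D : Finset ℕ} : ∀ {l l' : List ℕ} {p a : ℕ},
    l.Pairwise (· < ·) → l'.Pairwise (· < ·) → (∀ x ∈ l, p ≤ x) → (∀ x ∈ l', p ≤ x) →
    (∀ x ∈ D, x ∈ l ↔ x ∈ l') → describe D p a l = describe D p a l' → l = l' := by
  intro l
  induction l with
  | nil =>
    intro l' p a _ _ _ _ hD h
    rcases l' with _ | ⟨j, l'⟩
    · rfl
    · rw [describe, describe] at h
      split_ifs at h with hj
      simpa using (hD j hj).2 (by simp)
  | cons j l ih =>
    intro l' p a hl hl' hp hp' hD h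
    rcases l' with _ | ⟨j', l'⟩
    · rw [describe, describe] at h
      split_ifs at h with hj
      simpa using (hD j hj).1 (by simp)
    rw [List.pairwise_cons] at hl hl'
    have hjj : j = j' := by
      rw [describe, describe] at h
      split_ifs at h with hj hj' hj'
      · have h1 := (hD j hj).1 (by simp)
        have h2 := (hD j' hj').2 (by simp)
        rw [List.mem_cons] at h1 h2
        rcases h1 with h1 | h1
        · exact h1
        rcases h2 with h2 | h2
        · exact h2.symm
        exact absurd (hl.1 _ h2) (hl'.1 _ h1).asymm
      · have := le_of_describe_eq_cons h; omega
      · have := le_of_describe_eq_cons h.symm; omega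
      · simp only [List.cons.injEq] at h
        have h1 := hp j (by simp)
        have h2 := hp' j' (by simp)
        omega
    subst hjj
    have hD' : ∀ x ∈ D, x ∈ l ↔ x ∈ l' := by
      intro x hx
      have := hD x hx
      simp only [List.mem_cons] at this
      constructor
      · intro hxl
        exact (this.1 (Or.inr hxl)).resolve_left (hl.1 x hxl).ne'
      · intro hxl
        exact (this.2 (Or.inr hxl)).resolve_left (hl'.1 x hxl).ne'
    have h1 : ∀ x ∈ l, j ≤ x := fun x hx => (hl.1 x hx).le
    have h2 : ∀ x ∈ l', j ≤ x := fun x hx => (hl'.1 x hx).le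
    rw [describe, describe] at h
    split_ifs at h with hj
    · rw [ih hl.2 hl'.2 h1 h2 hD' h]
    · simp only [List.cons.injEq, true_and] at h
      rw [ih hl.2 hl'.2 h1 h2 hD' h]

/-- The sum of `φ` over the consecutive differences of `p :: l`. -/
def diffSum (φ : ℕ → ℕ) : ℕ → List ℕ → ℕ
  | _, [] => 0
  | p, j :: l => φ (j - p) + diffSum φ j l

/-- The bound `a.size ≤ H + a / 2 ^ H` with denominators cleared. It trades `H` bits per number
against a small multiple of the number itself. -/
lemma size_le_add (a H : ℕ) : a.size * 2 ^ H ≤ H * 2 ^ H + a := by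
  rcases le_or_gt a.size H with h | h
  · have := Nat.mul_le_mul_right (2 ^ H) h
    omega
  · obtain ⟨d, hd⟩ : ∃ d, a.size = H + d + 1 := ⟨a.size - H - 1, by omega⟩
    have h1 : 2 ^ (H + d) ≤ a := Nat.lt_size.1 (by omega)
    have h2 : d + 1 ≤ 2 ^ d := Nat.lt_two_pow_self
    rw [hd, pow_add] at *
    have := Nat.mul_le_mul_left (2 ^ H) h2
    nlinarith

/-- The emitted counts add up to at most `a + l.length`, so their logarithms cost `H` bits per
listed entry plus a total of order `(a + l.length) / 2 ^ H`. -/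
lemma cost_describe_le (D : Finset ℕ) (H : ℕ) : ∀ (l : List ℕ) (p a : ℕ),
    cost (describe D p a l) * 2 ^ H ≤
      (4 + 4 * H) * (l.filter (· ∉ D)).length * 2 ^ H + 2 * (a + l.length) +
        2 * diffSum (fun x => x.size - H) p l * 2 ^ H
  | [], p, a => by simp [describe, cost]
  | j :: l, p, a => by
    rw [describe]
    split_ifs with hj
    · have ih := cost_describe_le D H l j (a + 1)
      have e : ((j :: l).filter (· ∉ D)).length = (l.filter (· ∉ D)).length := by
        simp [hj]
      rw [e, diffSum, List.length_cons]
      nlinarith [Nat.zero_le (2 ^ H), Nat.zero_le (((j - p).size - H) * 2 ^ H)]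
    · have ih := cost_describe_le D H l j 0
      have e : ((j :: l).filter (· ∉ D)).length = (l.filter (· ∉ D)).length + 1 := by
        simp [hj]
      have e2 : cost (a :: (j - p) :: describe D j 0 l) =
          2 * a.size + 2 + (2 * (j - p).size + 2 + cost (describe D j 0 l)) := by
        simp [cost]
      rw [e, e2, diffSum, List.length_cons]
      have h1 := size_le_add a H
      have h2 : (j - p).size * 2 ^ H ≤ (H + ((j - p).size - H)) * 2 ^ H :=
        Nat.mul_le_mul_right _ (by omega)
      nlinarith

lemma diffSum_dedup_le (φ : ℕ → ℕ) (h0 : φ 0 = 0) : ∀ (l : List ℕ) (p : ℕ),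
    l.Pairwise (· ≤ ·) → diffSum φ p l.dedup ≤ diffSum φ p l
  | [], p, _ => by simp
  | j :: l, p, h => by
    rw [List.pairwise_cons] at h
    by_cases hj : j ∈ l
    · rw [List.dedup_cons_of_mem hj]
      refine (diffSum_dedup_le φ h0 l p h.2).trans ?_
      rcases l with _ | ⟨k, l⟩
      · simp at hj
      · have : k = j := by
          have h2 := h.2
          rw [List.pairwise_cons] at h2
          rw [List.mem_cons] at hj
          rcases hj with hj | hj
          · exact hj.symm
          · exact le_antisymm (h2.1 j hj) (h.1 k (by simp))
        subst this
        simp [diffSum, h0]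
    · rw [List.dedup_cons_of_notMem hj, diffSum, diffSum]
      exact Nat.add_le_add_left (diffSum_dedup_le φ h0 l j h.2) _

lemma length_le_diffSum (φ : ℕ → ℕ) (h1 : ∀ x, 1 ≤ x → 1 ≤ φ x) : ∀ (l : List ℕ) (p : ℕ),
    (p :: l).Pairwise (· < ·) → l.length ≤ diffSum φ p l
  | [], p, _ => by simp
  | j :: l, p, h => by
    rw [List.pairwise_cons] at h
    have := length_le_diffSum φ h1 l j h.2
    have h3 := h.1 j (by simp)
    have := h1 (j - p) (by omega)
    rw [diffSum, List.length_cons]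
    omega

lemma pairwise_dedup {l : List ℕ} (h : l.Pairwise (· ≤ ·)) : l.dedup.Pairwise (· < ·) :=
  ((h.sublist (List.dedup_sublist l)).and l.nodup_dedup).imp fun h => lt_of_le_of_ne h.1 h.2

lemma length_le_succ_diffSum (φ : ℕ → ℕ) (h1 : ∀ x, 1 ≤ x → 1 ≤ φ x) (l : List ℕ) (p : ℕ)
    (h : l.Pairwise (· < ·)) : l.length ≤ 1 + diffSum φ p l := by
  rcases l with _ | ⟨j, l⟩
  · simp
  · have := length_le_diffSum φ h1 l j h
    rw [diffSum, List.length_cons]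
    omega

lemma diffSum_eq_sum (φ : ℕ → ℕ) : ∀ (l : List ℕ) (p : ℕ),
    diffSum φ p l = ∑ i ∈ range l.length, φ ((p :: l).getD (i + 1) 0 - (p :: l).getD i 0)
  | [], p => by simp [diffSum]
  | j :: l, p => by
    rw [diffSum, diffSum_eq_sum φ l j, List.length_cons, sum_range_succ']
    simp only [List.getD_cons_succ, List.getD_cons_zero]
    rw [add_comm]

/-! ### Intervals with a random offset -/

/-- The index, shifted by one, of the interval `[δ + j L, δ + (j + 1) L)` that contains `x`. -/
def blk (L δ x : ℕ) : ℕ := (x + L - δ) / L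

section blk

variable {L δ : ℕ}

lemma blk_mono {x y : ℕ} (h : x ≤ y) : blk L δ x ≤ blk L δ y :=
  Nat.div_le_div_right (by omega)

lemma blk_zero (hδ : δ ∈ Icc 1 L) : blk L δ 0 = 0 := by
  rw [mem_Icc] at hδ
  exact Nat.div_eq_of_lt (by omega)

lemma blk_eq_iff (hδ : δ ∈ Icc 1 L) (x : ℕ) (j : ℤ) :
    ((δ : ℤ) + j * L ≤ x ∧ (x : ℤ) < δ + (j + 1) * L) ↔ (blk L δ x : ℤ) = j + 1 := by
  rw [mem_Icc] at hδ
  have hL : 0 < L := by omega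
  have h1 : blk L δ x * L ≤ x + L - δ := Nat.div_mul_le_self _ _
  have h2 : x + L - δ < (blk L δ x + 1) * L := Nat.lt_mul_of_div_lt (Nat.lt_succ_self _) hL
  generalize blk L δ x = b at *
  zify [show δ ≤ x + L by omega] at h1 h2
  have hL' : (0 : ℤ) < L := by exact_mod_cast hL
  constructor
  · rintro ⟨h3, h4⟩
    apply le_antisymm
    · by_contra! h
      nlinarith [mul_le_mul_of_nonneg_right (Int.add_one_le_iff.2 h) hL'.le]
    · by_contra! h
      nlinarith [mul_le_mul_of_nonneg_right (Int.add_one_le_iff.2 h) hL'.le]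
  · intro h
    rw [h] at h1 h2
    constructor <;> nlinarith

lemma E_eq (hδ : δ ∈ Icc 1 L) (T : Finset ℕ) (j : ℤ) :
    E L δ T j = decide (∃ b ∈ T.image (blk L δ), (b : ℤ) = j + 1) := by
  rw [E, decide_eq_decide]
  simp only [mem_image, exists_exists_and_eq_and, blk_eq_iff hδ]

lemma mul_lt_of_lt_blk_sub (hδ : δ ∈ Icc 1 L) {x y d : ℕ} (h : d + 1 ≤ blk L δ y - blk L δ x) :
    d * L < y - x := by
  rw [mem_Icc] at hδ
  have hL : 0 < L := by omega
  have h1 : blk L δ y * L ≤ y + L - δ := Nat.div_mul_le_self _ _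
  have h2 : x + L - δ < (blk L δ x + 1) * L := Nat.lt_mul_of_div_lt (Nat.lt_succ_self _) hL
  have h3 := Nat.mul_le_mul_right L (show blk L δ x + 1 + d ≤ blk L δ y by omega)
  rw [add_mul _ d] at h3
  omega

/-- Hermite's identity. On average over the offsets, the number of boundaries between two points is
their distance divided by `L`. -/
lemma sum_blk (hL : 0 < L) (x : ℕ) : ∑ δ ∈ Icc 1 L, blk L δ x = x := by
  have h : ∀ x, ∑ δ ∈ Icc 1 L, blk L δ x = ∑ r ∈ range L, (x + r) / L := by
    intro x
    refine sum_bij' (fun δ _ => L - δ) (fun r _ => L - r) ?_ ?_ ?_ ?_ ?_ <;>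
      simp only [mem_Icc, mem_range, and_imp]
    · intros; omega
    · intros; omega
    · intros; omega
    · intros; omega
    · intro δ h1 h2
      rw [blk, Nat.add_sub_assoc h2]
  rw [h]
  induction x with
  | zero =>
    refine sum_eq_zero fun r hr => ?_
    rw [mem_range] at hr
    exact Nat.div_eq_of_lt (by omega)
  | succ x ih =>
    have h1 : ∑ r ∈ range (L + 1), (x + r) / L = x + (x + L) / L := by
      rw [sum_range_succ, ih]
    rw [sum_range_succ', Nat.add_div_right _ hL] at h1
    simp only [add_zero] at h1
    rw [sum_congr rfl fun r _ => by rw [show x + 1 + r = x + (r + 1) by ring]]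
    omega

lemma card_blk_lt_le (hL : 0 < L) {x y : ℕ} (h : x ≤ y) :
    #{δ ∈ Icc 1 L | blk L δ x < blk L δ y} ≤ min L (y - x) := by
  refine le_min ((card_filter_le _ _).trans (by simp)) ?_
  rw [card_filter]
  calc ∑ δ ∈ Icc 1 L, (if blk L δ x < blk L δ y then 1 else 0)
      ≤ ∑ δ ∈ Icc 1 L, (blk L δ y - blk L δ x) := by
        refine sum_le_sum fun δ _ => ?_
        split_ifs <;> omega
    _ = y - x := by
        rw [sum_tsub_distrib _ fun δ _ => blk_mono h, sum_blk hL, sum_blk hL]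

/-- The two boundary events share one offset and are not independent. If they ever occur together
then `z - x > L`, so one truncated distance is at least `L / 2`; bounding the joint count by the
other one loses only a factor 2. -/
lemma mul_card_blk_lt_lt_le (hL : 0 < L) {x y z : ℕ} (h : x ≤ y) (h' : y ≤ z) :
    L * #{δ ∈ Icc 1 L | blk L δ x < blk L δ y ∧ blk L δ y < blk L δ z} ≤
      2 * (min L (y - x) * min L (z - y)) := by
  by_cases hne : ∃ δ ∈ Icc 1 L, blk L δ x < blk L δ y ∧ blk L δ y < blk L δ z
  · obtain ⟨δ, hδ, h1, h2⟩ := hne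
    have h3 := mul_lt_of_lt_blk_sub hδ (show 1 + 1 ≤ blk L δ z - blk L δ x by omega)
    have e1 : #{δ ∈ Icc 1 L | blk L δ x < blk L δ y ∧ blk L δ y < blk L δ z} ≤ min L (y - x) :=
      (card_le_card (monotone_filter_right _ fun _ _ h => h.1)).trans (card_blk_lt_le hL h)
    have e2 : #{δ ∈ Icc 1 L | blk L δ x < blk L δ y ∧ blk L δ y < blk L δ z} ≤ min L (z - y) :=
      (card_le_card (monotone_filter_right _ fun _ _ h => h.2)).trans (card_blk_lt_le hL h')
    rcases le_total L (2 * min L (y - x)) with h4 | h4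
    · calc _ ≤ (2 * min L (y - x)) * min L (z - y) := Nat.mul_le_mul h4 e2
        _ = _ := by ring
    · have h5 : L ≤ 2 * min L (z - y) := by omega
      calc _ ≤ (2 * min L (z - y)) * min L (y - x) := Nat.mul_le_mul h5 e1
        _ = _ := by ring
  · rw [filter_eq_empty_iff.2 fun δ hδ h => hne ⟨δ, hδ, h⟩]
    simp

end blk

/-! ### The codeword and its decoding -/

/-- The codeword: the offset, followed by the description of the non-empty intervals relative to
those that meet `T'`. -/
def code (L δ : ℕ) (T T' : Finset ℕ) : List Bool :=
  encList (δ :: describe (T'.image (blk L δ)) 0 0 ((T.sort (· ≤ ·)).map (blk L δ)).dedup)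

lemma pairwise_map_blk (L δ : ℕ) (T : Finset ℕ) :
    ((T.sort (· ≤ ·)).map (blk L δ)).Pairwise (· ≤ ·) :=
  List.pairwise_map.2 ((T.pairwise_sort (· ≤ ·)).imp fun h => blk_mono h)

lemma mem_dedup_map_blk {L δ : ℕ} {T : Finset ℕ} {b : ℕ} :
    b ∈ ((T.sort (· ≤ ·)).map (blk L δ)).dedup ↔ b ∈ T.image (blk L δ) := by
  simp

lemma prefixFree_code (L U m : ℕ) : PrefixFree L U m (code L) := by
  rintro δ₁ T₁ T₁' δ₂ T₂ T₂' - - ⟨t, ht⟩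
  have : code L δ₁ T₁ T₁' ++ t = code L δ₂ T₂ T₂' ++ [] := by rw [ht, List.append_nil]
  rw [code, code, (encList_append_inj this).1]

/-- The offset is decoded first, which makes the intervals meeting `T'` known. They occur in both
lists because `T'` lies in both sets, so `describe_inj` applies. -/
lemma image_blk_eq_of_code_eq {L U m δ₁ δ₂ : ℕ} {T₁ T₂ T' : Finset ℕ}
    (h₁ : Valid L U m δ₁ T₁ T') (h₂ : Valid L U m δ₂ T₂ T')
    (h : code L δ₁ T₁ T' = code L δ₂ T₂ T') :
    δ₁ = δ₂ ∧ T₁.image (blk L δ₁) = T₂.image (blk L δ₂) := by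
  have h' : code L δ₁ T₁ T' ++ [] = code L δ₂ T₂ T' ++ [] := by rw [h]
  have h3 := (encList_append_inj h').1
  rw [List.cons.injEq] at h3
  obtain ⟨rfl, h3⟩ := h3
  refine ⟨rfl, ?_⟩
  have := describe_inj (pairwise_dedup (pairwise_map_blk L δ₁ T₁))
    (pairwise_dedup (pairwise_map_blk L δ₁ T₂)) (fun _ _ => Nat.zero_le _)
    (fun _ _ => Nat.zero_le _) (fun x hx => by
      rw [mem_dedup_map_blk, mem_dedup_map_blk]
      exact ⟨fun _ => image_subset_image h₂.2.2 hx, fun _ => image_subset_image h₁.2.2 hx⟩) h3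
  ext b
  rw [← mem_dedup_map_blk, this, mem_dedup_map_blk]

lemma determines_code (L U m : ℕ) : Determines L U m (code L) := by
  classical
  -- The decoder searches for any valid triple producing the word; all such triples have the same
  -- offset and the same non-empty intervals.
  refine ⟨fun w T' j => decide (∃ δ T, Valid L U m δ T T' ∧ code L δ T T' = w ∧ E L δ T j = true),
    fun δ T T' h j => ?_⟩
  rw [Bool.eq_iff_iff, decide_eq_true_iff]
  constructor
  · rintro ⟨δ₂, T₂, h2, hc, hE⟩
    obtain ⟨rfl, hi⟩ := image_blk_eq_of_code_eq h2 h hc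
    rwa [E_eq h.1, hi, ← E_eq h.1] at hE
  · intro hE
    exact ⟨δ, T, h, rfl, hE⟩

/-! ### Pointwise bounds for the length and its ingredients -/

section counts

variable {L U m δ t H : ℕ} {T T' : Finset ℕ}

/-- The number of non-empty intervals with at most `t` points. -/
def sparse (L δ t : ℕ) (T : Finset ℕ) : Finset ℕ :=
  (T.image (blk L δ)).filter fun b => #{s ∈ T | blk L δ s = b} ≤ t

/-- A missed interval that is not sparse contains at least `t + 1` points, all of them in `T \ T'`,
and different intervals lose disjoint sets of points. -/
lemma mul_card_missed_le (hT' : T' ⊆ T) :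
    (t + 1) * #(T.image (blk L δ) \ T'.image (blk L δ)) ≤
      (t + 1) * #(sparse L δ t T) + (#T - #T') := by
  set G := (T.image (blk L δ) \ T'.image (blk L δ)).filter fun b =>
    ¬ #{s ∈ T | blk L δ s = b} ≤ t with hG
  have h1 : #(T.image (blk L δ) \ T'.image (blk L δ)) ≤ #(sparse L δ t T) + #G := by
    rw [← card_filter_add_card_filter_not (s := T.image (blk L δ) \ T'.image (blk L δ))
      (fun b => #{s ∈ T | blk L δ s = b} ≤ t)]
    refine Nat.add_le_add_right (card_le_card (filter_subset_filter _ sdiff_subset)) _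
  have h2 : (t + 1) * #G ≤ #T - #T' := by
    rw [← card_sdiff_of_subset hT']
    calc (t + 1) * #G = ∑ b ∈ G, (t + 1) := by simp [mul_comm]
      _ ≤ ∑ b ∈ G, #{s ∈ (T \ T').filter (fun s => blk L δ s ∈ G) | blk L δ s = b} := by
          refine sum_le_sum fun b hb => ?_
          have hb' := hb
          rw [hG, mem_filter, mem_sdiff] at hb'
          refine le_trans (by omega : t + 1 ≤ #{s ∈ T | blk L δ s = b})
            (card_le_card fun s hs => ?_)
          rw [mem_filter] at hs
          rw [mem_filter, mem_filter, mem_sdiff]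
          refine ⟨⟨⟨hs.1, fun hs' => hb'.1.2 ?_⟩, hs.2 ▸ hb⟩, hs.2⟩
          exact mem_image.2 ⟨s, hs', hs.2⟩
      _ = #((T \ T').filter (fun s => blk L δ s ∈ G)) :=
          (card_eq_sum_card_fiberwise fun s hs => (mem_filter.1 hs).2).symm
      _ ≤ _ := card_filter_le _ _
  calc _ ≤ (t + 1) * (#(sparse L δ t T) + #G) := Nat.mul_le_mul_left _ h1
    _ = (t + 1) * #(sparse L δ t T) + (t + 1) * #G := by ring
    _ ≤ _ := by omega

lemma diffSum_blk_le (hδ : δ ∈ Icc 1 L) (hT : T ∈ subsets U m) (φ : ℕ → ℕ) (h0 : φ 0 = 0) :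
    diffSum φ 0 ((T.sort (· ≤ ·)).map (blk L δ)).dedup ≤
      ∑ i ∈ range m, φ (blk L δ (pt U T (i + 1)) - blk L δ (pt U T i)) := by
  refine (diffSum_dedup_le φ h0 _ 0 (pairwise_map_blk L δ T)).trans_eq ?_
  obtain ⟨_, rfl⟩ := mem_subsets.1 hT
  rw [diffSum_eq_sum, List.length_map, length_sort]
  have h : ∀ i ≤ T.card, (0 :: (T.sort (· ≤ ·)).map (blk L δ)).getD i 0 = blk L δ (pt U T i) := by
    intro i hi
    rcases i with _ | i
    · rw [pt_zero, blk_zero hδ, List.getD_cons_zero]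
    · rw [List.getD_cons_succ, pt_succ_of_lt (by omega), List.getD_eq_getElem _ _ (by simp; omega),
        List.getElem_map]
  refine sum_congr rfl fun i hi => ?_
  rw [mem_range] at hi
  rw [h _ hi, h _ hi.le]

/-- The number of consecutive points in different intervals. -/
def jumps (L U m δ : ℕ) (T : Finset ℕ) : ℕ :=
  ∑ i ∈ range m, if blk L δ (pt U T i) < blk L δ (pt U T (i + 1)) then 1 else 0

/-- The excess bit length of the distances between consecutive non-empty intervals. -/
def excess (L U m δ H : ℕ) (T : Finset ℕ) : ℕ :=
  ∑ i ∈ range m, ((blk L δ (pt U T (i + 1)) - blk L δ (pt U T i)).size - H)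

lemma length_code_le (hδ : δ ∈ Icc 1 L) (hT : T ∈ subsets U m) (H : ℕ) :
    (code L δ T T').length * 2 ^ H ≤ (2 * δ.size + 3) * 2 ^ H +
      (4 + 4 * H) * #(T.image (blk L δ) \ T'.image (blk L δ)) * 2 ^ H +
      2 * (1 + jumps L U m δ T) + 2 * excess L U m δ H T * 2 ^ H := by
  set l := ((T.sort (· ≤ ·)).map (blk L δ)).dedup with hl
  have hlp : l.Pairwise (· < ·) := pairwise_dedup (pairwise_map_blk L δ T)
  have h1 := cost_describe_le (T'.image (blk L δ)) H l 0 0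
  have h2 : (l.filter (· ∉ T'.image (blk L δ))).length =
      #(T.image (blk L δ) \ T'.image (blk L δ)) := by
    rw [← List.toFinset_card_of_nodup ((List.nodup_dedup _).filter _)]
    congr 1
    ext b
    simp only [List.mem_toFinset, List.mem_filter, mem_dedup_map_blk, mem_sdiff,
      decide_eq_true_iff]
  have h3 : l.length ≤ 1 + jumps L U m δ T := by
    refine (length_le_succ_diffSum (fun x => if 0 < x then 1 else 0)
      (fun x hx => (if_pos hx).ge) l 0 hlp).trans (Nat.add_le_add_left
      ((diffSum_blk_le hδ hT _ (by simp)).trans_eq ?_) _)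
    simp only [jumps, tsub_pos_iff_lt]
  have h4 : diffSum (fun x => x.size - H) 0 l ≤ excess L U m δ H T :=
    diffSum_blk_le hδ hT _ (by simp)
  have h5 : (code L δ T T').length =
      2 * δ.size + 3 + cost (describe (T'.image (blk L δ)) 0 0 l) := by
    rw [code, length_encList]
    simp only [cost, List.map_cons, List.sum_cons, hl]
    ring
  rw [h5, add_mul]
  rw [h2] at h1
  have h6 := Nat.mul_le_mul_right (2 ^ H) h4
  nlinarith

lemma excess_le (hδ : δ ∈ Icc 1 L) (hT : T ∈ subsets U m) (H : ℕ) :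
    excess L U m δ (H + 1) T ≤ ∑ i ∈ range m, ∑ h ∈ range (U + 1),
      if 2 ^ (H + h) * L ≤ gaps U m T i + 1 then 1 else 0 := by
  refine sum_le_sum fun i hi => ?_
  rw [mem_range] at hi
  have e := pt_succ_eq hT (show i < m + 1 by omega)
  set x := blk L δ (pt U T (i + 1)) - blk L δ (pt U T i) with hx
  have hU : pt U T (i + 1) ≤ U + 1 := by
    have := pt_le_pt hT (show i + 1 ≤ m + 1 by omega) le_rfl
    rwa [← (mem_subsets.1 hT).2, pt_card_succ] at this
  -- The extra `1` in `H + 1` pays for the incomplete intervals at both ends: a block distance of `2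
  -- * 2 ^ (H + h)` guarantees a gap longer than `2 ^ (H + h)` interval lengths.
  have hkey : ∀ h, 2 ^ (H + 1 + h) ≤ x → 2 ^ (H + h) * L ≤ gaps U m T i + 1 := by
    intro h hh
    have h1 : 2 ^ (H + 1 + h) = 2 ^ (H + h) + 2 ^ (H + h) := by ring
    have h2 : 0 < 2 ^ (H + h) := by positivity
    have := mul_lt_of_lt_blk_sub hδ (show 2 ^ (H + h) + 1 ≤ x by omega)
    omega
  have hxU : x.size ≤ H + 1 + (U + 1) := by
    rw [Nat.size_le]
    have h1 : x ≤ U + 1 := by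
      rcases Nat.eq_zero_or_pos x with h0 | h0
      · omega
      obtain ⟨d, hd⟩ : ∃ d, x = d + 1 := ⟨x - 1, by omega⟩
      have h1 := mul_lt_of_lt_blk_sub hδ hd.ge
      rw [mem_Icc] at hδ
      have h2 : d ≤ d * L := Nat.le_mul_of_pos_right _ (by omega)
      omega
    exact h1.trans_lt (Nat.lt_two_pow_self.trans_le (Nat.pow_le_pow_right two_pos (by omega)))
  calc x.size - (H + 1) = #(range (x.size - (H + 1))) := by simp
    _ ≤ #{h ∈ range (U + 1) | 2 ^ (H + h) * L ≤ gaps U m T i + 1} := by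
        refine card_le_card fun h hh => ?_
        rw [mem_range] at hh
        rw [mem_filter, mem_range]
        exact ⟨by omega, hkey h (Nat.lt_size.1 (by omega))⟩
    _ = _ := by rw [card_filter]

lemma card_sparse_le (hT : T ∈ subsets U m) (t : ℕ) :
    #(sparse L δ t T) ≤ 2 + ∑ i ∈ range m,
      if blk L δ (pt U T i) < blk L δ (pt U T (i + 1)) ∧
        blk L δ (pt U T (i + 1)) < blk L δ (pt U T (min (i + 1 + t) m)) then 1 else 0 := by
  rw [← card_filter]
  set I := {i ∈ range m | blk L δ (pt U T i) < blk L δ (pt U T (i + 1)) ∧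
        blk L δ (pt U T (i + 1)) < blk L δ (pt U T (min (i + 1 + t) m))} with hI
  -- The two exceptional blocks are that of the point 0 and that of the last point. In any other
  -- sparse block, let `i + 1` index its first point: the previous point lies in an earlier block,
  -- and `t` points later the block has been left, as otherwise it would hold `t + 1` points.
  have hsub : sparse L δ t T ⊆ {blk L δ (pt U T 0), blk L δ (pt U T m)} ∪
      I.image fun i => blk L δ (pt U T (i + 1)) := by
    intro b hb
    rw [sparse, mem_filter] at hb
    obtain ⟨hb, hbt⟩ := hb
    rw [mem_union, mem_insert, mem_singleton]
    by_contra! hcon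
    obtain ⟨⟨hb0, hbm⟩, hbI⟩ := hcon
    apply hbI
    obtain ⟨s, hs, rfl⟩ := mem_image.1 hb
    obtain ⟨j, hj, rfl⟩ := (mem_iff_exists_pt hT).1 hs
    have hex : ∃ k, blk L δ (pt U T k) = blk L δ (pt U T (j + 1)) := ⟨_, rfl⟩
    classical
    obtain ⟨k, hk, hmin⟩ : ∃ k, blk L δ (pt U T k) = blk L δ (pt U T (j + 1)) ∧
        ∀ i < k, blk L δ (pt U T i) ≠ blk L δ (pt U T (j + 1)) :=
      ⟨Nat.find hex, Nat.find_spec hex, fun i hi => Nat.find_min hex hi⟩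
    have hkj : k ≤ j + 1 := by
      by_contra! h
      exact hmin _ h rfl
    obtain ⟨i, rfl⟩ : ∃ i, k = i + 1 := by
      refine ⟨k - 1, ?_⟩
      have : k ≠ 0 := by rintro rfl; exact hb0 hk.symm
      omega
    rw [mem_image]
    refine ⟨i, ?_, hk⟩
    rw [hI, mem_filter, mem_range, hk]
    have hlt : blk L δ (pt U T i) < blk L δ (pt U T (j + 1)) := by
      refine lt_of_le_of_ne ?_ (hmin i (by omega))
      exact blk_mono (pt_le_pt hT (by omega) (by omega))
    refine ⟨by omega, hlt, ?_⟩
    rw [← hk]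
    refine lt_of_le_of_ne (blk_mono (pt_le_pt hT (by omega) (by omega))) fun heq => ?_
    rcases le_total m (i + 1 + t) with h | h
    · rw [min_eq_right h] at heq
      exact hbm (hk.symm.trans heq)
    · rw [min_eq_left h] at heq
      have : #((range (t + 1)).image fun l => pt U T (i + l + 1)) ≤
          #{s ∈ T | blk L δ s = blk L δ (pt U T (j + 1))} := by
        refine card_le_card fun s hs => ?_
        obtain ⟨l, hl, rfl⟩ := mem_image.1 hs
        rw [mem_range] at hl
        rw [mem_filter]
        refine ⟨(mem_iff_exists_pt hT).2 ⟨i + l, by omega, rfl⟩, le_antisymm ?_ ?_⟩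
        · rw [← hk, heq]
          exact blk_mono (pt_le_pt hT (by omega) (by omega))
        · rw [← hk]
          exact blk_mono (pt_le_pt hT (by omega) (by omega))
      rw [card_image_of_injOn, card_range] at this
      · omega
      · intro a ha c hc hac
        rw [mem_coe, mem_range] at ha hc
        by_contra hne
        rcases Nat.lt_or_gt_of_ne hne with h1 | h1
        · exact (pt_lt_pt hT (show i + a + 1 < i + c + 1 by omega) (by omega)).ne hac
        · exact (pt_lt_pt hT (show i + c + 1 < i + a + 1 by omega) (by omega)).ne' hac
  refine (card_le_card hsub).trans ((card_union_le _ _).trans ?_)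
  exact Nat.add_le_add card_le_two card_image_le

lemma sum_jumps_le (hL : 0 < L) (hT : T ∈ subsets U m) :
    ∑ δ ∈ Icc 1 L, jumps L U m δ T ≤ ∑ i ∈ range m, min L (gaps U m T i + 1) := by
  simp only [jumps]
  rw [sum_comm]
  refine sum_le_sum fun i hi => ?_
  rw [mem_range] at hi
  have e := pt_succ_eq hT (show i < m + 1 by omega)
  rw [← card_filter]
  refine (card_blk_lt_le hL (by omega)).trans_eq ?_
  rw [e, Nat.add_sub_cancel_left]

/-- Truncation is subadditive. This reduces the distance across several points to single gaps, so
that only pairs of gaps have to be averaged. -/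
lemma min_pt_sub_le (hT : T ∈ subsets U m) {a b : ℕ} (hab : a ≤ b) (hb : b ≤ m + 1) :
    min L (pt U T b - pt U T a) ≤ ∑ l ∈ Ico a b, min L (gaps U m T l + 1) := by
  induction b, hab using Nat.le_induction with
  | base => simp
  | succ b hab ih =>
    have ih := ih (by omega)
    rw [sum_Ico_succ_top hab]
    have e := pt_succ_eq hT (show b < m + 1 by omega)
    have := pt_le_pt hT hab (by omega)
    omega

lemma mul_sum_card_sparse_le (hL : 0 < L) (hT : T ∈ subsets U m) (t : ℕ) :
    L * ∑ δ ∈ Icc 1 L, #(sparse L δ t T) ≤ 2 * L ^ 2 +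
      2 * ∑ i ∈ range m, ∑ l ∈ Ico (i + 1) (min (i + 1 + t) m),
        min L (gaps U m T i + 1) * min L (gaps U m T l + 1) := by
  have h1 := sum_le_sum fun δ (_ : δ ∈ Icc 1 L) => card_sparse_le (L := L) (δ := δ) hT t
  rw [sum_add_distrib, sum_comm, sum_const, Nat.card_Icc, smul_eq_mul] at h1
  refine (Nat.mul_le_mul_left L h1).trans ?_
  rw [mul_add, mul_sum, mul_sum]
  refine Nat.add_le_add (by rw [Nat.add_sub_cancel]; nlinarith) (sum_le_sum fun i hi => ?_)
  rw [mem_range] at hi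
  rw [← card_filter, ← mul_sum]
  have e := pt_succ_eq hT (show i < m + 1 by omega)
  refine (mul_card_blk_lt_lt_le hL (by omega) (pt_le_pt hT (by omega) (by omega))).trans ?_
  rw [show pt U T (i + 1) - pt U T i = gaps U m T i + 1 by omega]
  gcongr
  exact min_pt_sub_le hT (by omega) (by omega)

end counts

/-! ### Averages over the Catalan law and the offset -/

section averages

variable {K : ℝ} {U m L : ℕ}

lemma Regular.average_jumps_le (h : Regular K U m) (hL : 0 < L) :
    ∑ T ∈ subsets U m, setProb U m T * (∑ δ ∈ Icc 1 L, (jumps L U m δ T : ℝ)) ≤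
      2 * K * m * √L := by
  calc _ ≤ ∑ T ∈ subsets U m, setProb U m T *
        ∑ i ∈ range m, ((min L (gaps U m T i + 1) : ℕ) : ℝ) := by
        refine sum_le_sum fun T hT => mul_le_mul_of_nonneg_left ?_ setProb_nonneg
        exact_mod_cast sum_jumps_le hL hT
    _ = ∑ i ∈ range m, ∑ T ∈ subsets U m, setProb U m T *
        ((min L (gaps U m T i + 1) : ℕ) : ℝ) := by
        simp only [mul_sum]; rw [sum_comm]
    _ ≤ ∑ i ∈ range m, K * (2 * √L) := sum_le_sum fun i hi =>
        h.sum_min_le L (by rw [mem_range] at hi; omega)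
    _ = _ := by rw [sum_const, card_range, nsmul_eq_mul]; ring

lemma Regular.average_sparse_le (h : Regular K U m) (hL : 0 < L) (t : ℕ) :
    ∑ T ∈ subsets U m, setProb U m T * (∑ δ ∈ Icc 1 L, (#(sparse L δ t T) : ℝ)) ≤
      2 * L + 8 * K * m * t := by
  have hL' : (0 : ℝ) < L := by exact_mod_cast hL
  have hK := h.const_nonneg
  refine le_of_mul_le_mul_left ?_ hL'
  calc _ = ∑ T ∈ subsets U m, setProb U m T * (L * ∑ δ ∈ Icc 1 L, (#(sparse L δ t T) : ℝ)) := by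
        rw [mul_sum]; exact sum_congr rfl fun T _ => by ring
    _ ≤ ∑ T ∈ subsets U m, setProb U m T * (2 * (L : ℝ) ^ 2 +
          2 * ∑ i ∈ range m, ∑ l ∈ Ico (i + 1) (min (i + 1 + t) m),
            (((min L (gaps U m T i + 1) : ℕ) : ℝ) * ((min L (gaps U m T l + 1) : ℕ) : ℝ))) := by
        refine sum_le_sum fun T hT => mul_le_mul_of_nonneg_left ?_ setProb_nonneg
        exact_mod_cast mul_sum_card_sparse_le hL hT t
    _ = 2 * (L : ℝ) ^ 2 + 2 * ∑ i ∈ range m, ∑ l ∈ Ico (i + 1) (min (i + 1 + t) m),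
          ∑ T ∈ subsets U m, setProb U m T *
            (((min L (gaps U m T i + 1) : ℕ) : ℝ) * ((min L (gaps U m T l + 1) : ℕ) : ℝ)) := by
        simp only [mul_add, sum_add_distrib]
        rw [← sum_mul, sum_setProb h.M_pos, one_mul]
        congr 1
        have e : ∀ x y : ℝ, x * (2 * y) = 2 * (x * y) := fun x y => by ring
        simp only [e]
        rw [← mul_sum]
        congr 1
        simp only [mul_sum]
        rw [sum_comm]
        exact sum_congr rfl fun i _ => sum_comm
    _ ≤ 2 * (L : ℝ) ^ 2 + 2 * ∑ i ∈ range m, ∑ l ∈ Ico (i + 1) (min (i + 1 + t) m),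
          K * (4 * L) := by
        gcongr with i hi l hl
        rw [mem_range] at hi
        rw [mem_Ico] at hl
        exact h.sum_min_mul_min_le L (by omega) (by omega) (by omega)
    _ ≤ 2 * (L : ℝ) ^ 2 + 2 * ∑ i ∈ range m, (t : ℝ) * (K * (4 * L)) := by
        gcongr with i hi
        rw [sum_const, nsmul_eq_mul, Nat.card_Ico]
        gcongr
        omega
    _ = _ := by rw [sum_const, card_range, nsmul_eq_mul]; ring

/-- A geometric series with ratio `1 / √2 ≤ 3 / 4`, hence the factor 4. -/
lemma sum_inv_sqrt_le (H R : ℕ) (hL : 0 < L) :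
    ∑ h ∈ range R, 1 / √((2 ^ (H + h) * L : ℕ) : ℝ) ≤ 4 * (1 / √(2 ^ H : ℝ)) / √L := by
  have hL' : (0 : ℝ) < L := by exact_mod_cast hL
  have h2 : (√2 : ℝ) ^ 2 = 2 := Real.sq_sqrt (by norm_num)
  have h3 : (0 : ℝ) < √2 := by positivity
  have hq : 1 / √2 ≤ (3 / 4 : ℝ) := by
    rw [div_le_div_iff₀ h3 (by norm_num)]; nlinarith
  have e : ∀ h ∈ range R, 1 / √((2 ^ (H + h) * L : ℕ) : ℝ) =
      (1 / √(2 ^ H : ℝ) / √L) * (1 / √2) ^ h := by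
    intro h _
    have hp : √(2 ^ h : ℝ) = √2 ^ h := by
      rw [Real.sqrt_eq_iff_mul_self_eq (by positivity) (by positivity), ← mul_pow,
        Real.mul_self_sqrt (by norm_num)]
    push_cast
    rw [pow_add, Real.sqrt_mul (by positivity), Real.sqrt_mul (by positivity), hp, div_pow, one_pow]
    field_simp
  rw [sum_congr rfl e, ← mul_sum]
  have hg : ∑ h ∈ range R, (1 / √2 : ℝ) ^ h ≤ 4 := by
    calc ∑ h ∈ range R, (1 / √2 : ℝ) ^ h ≤ ∑ h ∈ range R, (3 / 4 : ℝ) ^ h := by gcongr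
      _ ≤ ∑' h, (3 / 4 : ℝ) ^ h := (summable_geometric_of_lt_one (by norm_num)
          (by norm_num)).sum_le_tsum _ fun _ _ => by positivity
      _ = 4 := by rw [tsum_geometric_of_lt_one (by norm_num) (by norm_num)]; norm_num
  calc _ ≤ (1 / √(2 ^ H : ℝ) / √L) * 4 := by gcongr
    _ = _ := by ring

lemma Regular.average_excess_le (h : Regular K U m) (hL : 0 < L) (H : ℕ) :
    ∑ T ∈ subsets U m, setProb U m T * (∑ δ ∈ Icc 1 L, (excess L U m δ (H + 1) T : ℝ)) ≤
      L * (4 * K * m * (1 / √(2 ^ H : ℝ)) / √L) := by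
  have hK := h.const_nonneg
  calc _ ≤ ∑ T ∈ subsets U m, setProb U m T * (L * ∑ i ∈ range m, ∑ h ∈ range (U + 1),
        if 2 ^ (H + h) * L ≤ gaps U m T i + 1 then (1 : ℝ) else 0) := by
        refine sum_le_sum fun T hT => mul_le_mul_of_nonneg_left ?_ setProb_nonneg
        refine (sum_le_sum (g := fun _ => ∑ i ∈ range m, ∑ h ∈ range (U + 1),
          if 2 ^ (H + h) * L ≤ gaps U m T i + 1 then (1 : ℝ) else 0) fun δ hδ => ?_).trans_eq ?_
        · exact_mod_cast excess_le hδ hT H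
        · rw [sum_const, nsmul_eq_mul, Nat.card_Icc, Nat.add_sub_cancel]
    _ = L * ∑ i ∈ range m, ∑ h ∈ range (U + 1), ∑ T ∈ subsets U m, setProb U m T *
        (if 2 ^ (H + h) * L ≤ gaps U m T i + 1 then (1 : ℝ) else 0) := by
        have e : ∀ x y : ℝ, x * (L * y) = L * (x * y) := fun x y => by ring
        simp only [e]
        rw [← mul_sum]
        congr 1
        simp only [mul_sum]
        rw [sum_comm]
        exact sum_congr rfl fun i _ => sum_comm
    _ ≤ L * ∑ i ∈ range m, ∑ h ∈ range (U + 1), K * (1 / √((2 ^ (H + h) * L : ℕ) : ℝ)) := by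
        gcongr with i hi h' hh'
        rw [mem_range] at hi
        exact h.sum_ite_le _ (by positivity) (by omega)
    _ ≤ L * ∑ i ∈ range m, K * (4 * (1 / √(2 ^ H : ℝ)) / √L) := by
        gcongr with i hi
        rw [← mul_sum]
        gcongr
        exact sum_inv_sqrt_le H _ hL
    _ = _ := by rw [sum_const, card_range, nsmul_eq_mul]; ring

/-- The part of the length bound that does not depend on the subset `T'`. -/
noncomputable def baseLength (L U m H t δ : ℕ) (T : Finset ℕ) : ℝ :=
  (2 * (L.size : ℝ) + 3) + (8 + 4 * H) * #(sparse L δ t T) +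
    (1 + (jumps L U m δ T : ℝ)) / 2 ^ H + 2 * excess L U m δ (H + 1) T

lemma baseLength_nonneg (L U m H t δ : ℕ) (T : Finset ℕ) : 0 ≤ baseLength L U m H t δ T := by
  unfold baseLength; positivity

/-- This isolates the dependence on `T'` in a term linear in the number of lost points, so only the
mean of that number will matter. -/
lemma length_code_le_baseLength {δ : ℕ} {T T' : Finset ℕ} (hδ : δ ∈ Icc 1 L)
    (hT : T ∈ subsets U m) (hT' : T' ⊆ T) (H : ℕ) {τ : ℝ} (hτ : 0 < τ) :
    ((code L δ T T').length : ℝ) ≤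
      baseLength L U m H ⌊τ⌋₊ δ T + (8 + 4 * H) / τ * ((m : ℝ) - T'.card) := by
  have h1 := length_code_le (T' := T') hδ hT (H + 1)
  have h2 := mul_card_missed_le (L := L) (δ := δ) (t := ⌊τ⌋₊) hT'
  rw [(mem_subsets.1 hT).2] at h2
  have hc : T'.card ≤ m := by rw [← (mem_subsets.1 hT).2]; exact card_le_card hT'
  set X := #(T.image (blk L δ) \ T'.image (blk L δ))
  have h3 : (X : ℝ) ≤ #(sparse L δ ⌊τ⌋₊ T) + ((m : ℝ) - T'.card) / τ := by
    have h2' : ((⌊τ⌋₊ : ℝ) + 1) * X ≤ (⌊τ⌋₊ + 1) * #(sparse L δ ⌊τ⌋₊ T) + ((m : ℝ) - T'.card) := by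
      rw [← Nat.cast_sub hc]; exact_mod_cast h2
    have ht : τ ≤ (⌊τ⌋₊ : ℝ) + 1 := (Nat.lt_floor_add_one τ).le
    have ht0 : (0 : ℝ) < (⌊τ⌋₊ : ℝ) + 1 := by positivity
    have hn : (0 : ℝ) ≤ (m : ℝ) - T'.card := sub_nonneg.2 (by exact_mod_cast hc)
    calc (X : ℝ) ≤ #(sparse L δ ⌊τ⌋₊ T) + ((m : ℝ) - T'.card) / ((⌊τ⌋₊ : ℝ) + 1) := by
          refine le_of_mul_le_mul_left (h2'.trans_eq ?_) ht0
          field_simp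
      _ ≤ _ := by gcongr
  have h4 : δ.size ≤ L.size := Nat.size_le_size (mem_Icc.1 hδ).2
  have h1' : ((code L δ T T').length : ℝ) * 2 ^ (H + 1) ≤ (2 * δ.size + 3) * 2 ^ (H + 1) +
      (4 + 4 * (H + 1)) * X * 2 ^ (H + 1) +
      2 * (1 + jumps L U m δ T) + 2 * excess L U m δ (H + 1) T * 2 ^ (H + 1) := by
    exact_mod_cast h1
  have h4' : (δ.size : ℝ) ≤ L.size := by exact_mod_cast h4
  have h5 : ((code L δ T T').length : ℝ) ≤ (2 * δ.size + 3) + (8 + 4 * H) * X +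
      (1 + jumps L U m δ T) / 2 ^ H + 2 * excess L U m δ (H + 1) T := by
    refine le_of_mul_le_mul_right (h1'.trans_eq ?_) (by positivity : (0 : ℝ) < 2 ^ (H + 1))
    rw [pow_succ]
    field_simp
    ring
  have h6 : (8 + 4 * (H : ℝ)) * X ≤
      (8 + 4 * H) * (#(sparse L δ ⌊τ⌋₊ T) + ((m : ℝ) - T'.card) / τ) := by gcongr
  unfold baseLength
  have h7 : (8 + 4 * (H : ℝ)) / τ * ((m : ℝ) - T'.card) =
    (8 + 4 * H) * (((m : ℝ) - T'.card) / τ) := by ring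
  rw [h7]
  linarith

lemma Regular.average_baseLength_le (h : Regular K U m) (hL : 0 < L) (H t : ℕ) :
    ∑ T ∈ subsets U m, ∑ δ ∈ Icc 1 L,
      baseLength L U m H t δ T * (setProb U m T * offsetProb L δ) ≤
      (2 * L.size + 3) + (8 + 4 * H) * (2 + 8 * K * m * t / L) +
        (1 + 2 * K * (m / √L)) / 2 ^ H + 8 * K * (m / √L) * (1 / √(2 ^ H : ℝ)) := by
  have hL' : (0 : ℝ) < L := by exact_mod_cast hL
  have e : ∑ T ∈ subsets U m, ∑ δ ∈ Icc 1 L,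
      baseLength L U m H t δ T * (setProb U m T * offsetProb L δ) =
      (2 * L.size + 3 + 1 / 2 ^ H) +
      (8 + 4 * H) / L * ∑ T ∈ subsets U m, setProb U m T * ∑ δ ∈ Icc 1 L, (#(sparse L δ t T) : ℝ) +
      1 / 2 ^ H / L * ∑ T ∈ subsets U m, setProb U m T * ∑ δ ∈ Icc 1 L, (jumps L U m δ T : ℝ) +
      2 / L * ∑ T ∈ subsets U m, setProb U m T *
        ∑ δ ∈ Icc 1 L, (excess L U m δ (H + 1) T : ℝ) := by
    have e1 : (2 * (L.size : ℝ) + 3 + 1 / 2 ^ H) = ∑ T ∈ subsets U m, setProb U m T *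
        ∑ δ ∈ Icc 1 L, (2 * (L.size : ℝ) + 3 + 1 / 2 ^ H) / L := by
      rw [← sum_mul, sum_setProb h.M_pos, sum_const, Nat.card_Icc, nsmul_eq_mul,
        Nat.add_sub_cancel]
      field_simp
    rw [e1]
    simp only [mul_sum, ← sum_add_distrib]
    refine sum_congr rfl fun T _ => sum_congr rfl fun δ hδ => ?_
    rw [offsetProb, if_pos hδ, baseLength]
    field_simp
    ring
  rw [e]
  have h1 := h.average_sparse_le hL t
  have h2 := h.average_jumps_le hL
  have h3 := h.average_excess_le hL H
  have hs : √(L : ℝ) * √L = L := Real.mul_self_sqrt hL'.le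
  have hs0 : 0 < √(L : ℝ) := Real.sqrt_pos.2 hL'
  calc _ ≤ (2 * (L.size : ℝ) + 3 + 1 / 2 ^ H) + (8 + 4 * H) / L * (2 * L + 8 * K * m * t) +
      1 / 2 ^ H / L * (2 * K * m * √L) +
      2 / L * (L * (4 * K * m * (1 / √(2 ^ H : ℝ)) / √L)) := by gcongr
    _ = _ := by
      have e1 : (8 + 4 * (H : ℝ)) / L * (2 * L + 8 * K * m * t) =
        (8 + 4 * H) * (2 + 8 * K * m * t / L) := by field_simp
      have e2 : 1 / 2 ^ H / (L : ℝ) * (2 * K * m * √L) = 2 * K * (m / √L) / 2 ^ H := by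
        nth_rewrite 1 [← hs]; field_simp
      have e3 : 2 / (L : ℝ) * (L * (4 * K * m * (1 / √(2 ^ H : ℝ)) / √L)) =
        8 * K * (m / √L) * (1 / √(2 ^ H : ℝ)) := by field_simp; ring
      rw [e1, e2, e3]; ring

end averages

/-! ### Choice of parameters -/

section arithmetic

/-- The total length bound in terms of the threshold `η`. -/
lemma total_length_le {K ℓ η ε : ℝ} {m L H B : ℕ} (hK : 0 ≤ K) (hℓ : ℓ = Real.logb 2 B)
    (hℓ1 : 1 ≤ ℓ) (hmB : m ≤ B) (hL : 1 ≤ L) (hLm : (L : ℝ) ≤ m ^ 2 / ℓ ^ 4)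
    (hLm' : (m : ℝ) ^ 2 / ℓ ^ 4 ≤ L + 1) (hη : 1 / ℓ ≤ η) (hη1 : η ≤ 1)
    (hεη : ε ≤ η ^ 2) (hH : 1 / √(2 ^ H : ℝ) ≤ η) (hH' : (H : ℝ) ≤ 2 * Real.logb 2 (1 / η) + 1) :
    ((2 * L.size + 3) + (8 + 4 * H) * (2 + 8 * K * m * (⌊η * m / ℓ ^ 2⌋₊ : ℕ) / L) +
        (1 + 2 * K * (m / √L)) / 2 ^ H + 8 * K * (m / √L) * (1 / √(2 ^ H : ℝ))) +
      (8 + 4 * H) / (η * m / ℓ ^ 2) * (m * ε) ≤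
      (46 + 212 * K) * (η * ℓ ^ 2 * (1 + Real.logb 2 (1 / η))) := by
  have hℓ0 : 0 < ℓ := by linarith
  have hη0 : 0 < η := lt_of_lt_of_le (by positivity) hη
  have hL' : (1 : ℝ) ≤ L := by exact_mod_cast hL
  have hm0 : (0 : ℝ) < m := by
    rcases Nat.eq_zero_or_pos m with rfl | h
    · norm_num at hLm; linarith
    · exact_mod_cast h
  have hm : 0 < m := by exact_mod_cast hm0
  set lam := Real.logb 2 (1 / η) with hlam
  have hlam0 : 0 ≤ lam := Real.logb_nonneg (by norm_num) (by rw [le_div_iff₀ hη0]; linarith)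
  set Y := η * ℓ ^ 2 with hY
  have hYℓ : ℓ ≤ Y := by
    rw [div_le_iff₀ hℓ0] at hη
    rw [hY]; nlinarith
  have hY1 : 1 ≤ Y := hℓ1.trans hYℓ
  -- Since `L ≥ 1`, taking the integer part loses at most a factor 2.
  have hLlow : (m : ℝ) ^ 2 ≤ 2 * ℓ ^ 4 * L := by
    rw [div_le_iff₀ (by positivity)] at hLm'
    have : 0 < ℓ ^ 4 := by positivity
    nlinarith
  -- the offset
  have hsize : (L.size : ℝ) ≤ 2 * ℓ + 1 := by
    obtain ⟨d, hd⟩ : ∃ d, L.size = d + 1 :=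
      ⟨L.size - 1, by have := Nat.size_pos.2 hL; omega⟩
    have h1 : 2 ^ d ≤ L := Nat.lt_size.1 (by omega)
    have h2 : (L : ℝ) ≤ (B : ℝ) ^ 2 := by
      refine hLm.trans ((div_le_self (by positivity) (one_le_pow₀ hℓ1)).trans ?_)
      gcongr
    have h3 : (2 : ℝ) ^ d ≤ (B : ℝ) ^ 2 := le_trans (by exact_mod_cast h1) h2
    have h4 := Real.logb_le_logb_of_le (by norm_num : (1 : ℝ) < 2) (by positivity) h3
    rw [Real.logb_pow, Real.logb_pow, Real.logb_self_eq_one (by norm_num), ← hℓ] at h4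
    rw [hd]; push_cast at h4 ⊢; linarith
  -- the ratio of `m` to the root of the interval length
  have hsqrt : (m : ℝ) / √L ≤ 2 * ℓ ^ 2 := by
    have hs0 : 0 < √(L : ℝ) := Real.sqrt_pos.2 (by linarith)
    rw [div_le_iff₀ hs0]
    refine abs_le_of_sq_le_sq' ?_ (by positivity) |>.2
    rw [mul_pow, Real.sq_sqrt (by linarith)]
    have : 0 ≤ ℓ ^ 4 * L := by positivity
    nlinarith
  have hfloor : (m : ℝ) * (⌊η * m / ℓ ^ 2⌋₊ : ℕ) / L ≤ 2 * Y := by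
    have h1 : ((⌊η * m / ℓ ^ 2⌋₊ : ℕ) : ℝ) ≤ η * m / ℓ ^ 2 := Nat.floor_le (by positivity)
    rw [div_le_iff₀ (by linarith)]
    calc (m : ℝ) * (⌊η * m / ℓ ^ 2⌋₊ : ℕ) ≤ m * (η * m / ℓ ^ 2) := by gcongr
      _ = η / ℓ ^ 2 * (m : ℝ) ^ 2 := by ring
      _ ≤ η / ℓ ^ 2 * (2 * ℓ ^ 4 * L) := by gcongr
      _ = 2 * Y * L := by rw [hY]; field_simp
  have hHb : 8 + 4 * (H : ℝ) ≤ 12 * (1 + lam) := by linarith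
  have hpow : 1 / (2 : ℝ) ^ H ≤ η := by
    have h1 : (1 / √(2 ^ H : ℝ)) ^ 2 = 1 / (2 : ℝ) ^ H := by
      rw [div_pow, Real.sq_sqrt (by positivity), one_pow]
    rw [← h1]
    calc (1 / √(2 ^ H : ℝ)) ^ 2 ≤ η ^ 2 := by gcongr
      _ ≤ η := by nlinarith
  have t1 : 2 * (L.size : ℝ) + 3 ≤ 9 * (Y * (1 + lam)) := by nlinarith
  have t2 : (8 + 4 * (H : ℝ)) * (2 + 8 * K * m * (⌊η * m / ℓ ^ 2⌋₊ : ℕ) / L) ≤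
      (12 * (1 + lam)) * ((2 + 16 * K) * Y) := by
    have : 2 + 8 * K * m * (⌊η * m / ℓ ^ 2⌋₊ : ℕ) / L ≤ (2 + 16 * K) * Y := by
      have e : 8 * K * m * (⌊η * m / ℓ ^ 2⌋₊ : ℕ) / (L : ℝ) =
        8 * K * ((m : ℝ) * (⌊η * m / ℓ ^ 2⌋₊ : ℕ) / L) := by ring
      rw [e]
      have := mul_le_mul_of_nonneg_left hfloor (by positivity : 0 ≤ 8 * K)
      linarith
    gcongr
  have t3 : (1 + 2 * K * (m / √L)) / 2 ^ H ≤ (1 + 4 * K) * (Y * (1 + lam)) := by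
    calc (1 + 2 * K * (m / √L)) / 2 ^ H = (1 + 2 * K * (m / √L)) * (1 / 2 ^ H) := by ring
      _ ≤ (1 + 2 * K * (2 * ℓ ^ 2)) * η := by gcongr
      _ ≤ (1 + 4 * K) * Y := by rw [hY]; nlinarith [one_le_pow₀ hℓ1 (n := 2)]
      _ ≤ (1 + 4 * K) * (Y * (1 + lam)) := by
        gcongr; exact le_mul_of_one_le_right (by linarith) (by linarith)
  have t4 : 8 * K * (m / √L) * (1 / √(2 ^ H : ℝ)) ≤ 16 * K * (Y * (1 + lam)) := by
    calc 8 * K * (m / √L) * (1 / √(2 ^ H : ℝ)) ≤ 8 * K * (2 * ℓ ^ 2) * η := by gcongr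
      _ = 16 * K * Y := by rw [hY]; ring
      _ ≤ 16 * K * (Y * (1 + lam)) := by
        gcongr; exact le_mul_of_one_le_right (by linarith) (by linarith)
  have t5 : (8 + 4 * (H : ℝ)) / (η * m / ℓ ^ 2) * (m * ε) ≤ 12 * (1 + lam) * Y := by
    calc (8 + 4 * (H : ℝ)) / (η * m / ℓ ^ 2) * (m * ε)
        = (8 + 4 * H) * (ℓ ^ 2 * (ε / η)) := by field_simp
      _ ≤ (8 + 4 * H) * (ℓ ^ 2 * η) := by
        gcongr
        rw [div_le_iff₀ hη0]; nlinarith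
      _ ≤ 12 * (1 + lam) * (ℓ ^ 2 * η) := by gcongr
      _ = _ := by rw [hY]; ring
  -- The five contributions are 9, 24 + 192K, 1 + 4K, 16K and 12.
  have e : (46 + 212 * K) * (Y * (1 + lam)) = 9 * (Y * (1 + lam)) +
      (12 * (1 + lam)) * ((2 + 16 * K) * Y) + (1 + 4 * K) * (Y * (1 + lam)) +
      16 * K * (Y * (1 + lam)) + 12 * (1 + lam) * Y := by ring
  rw [e]
  exact add_le_add (add_le_add (add_le_add (add_le_add t1 t2) t3) t4) t5

lemma exists_exponent {η : ℝ} (hη : 0 < η) (hη1 : η ≤ 1) :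
    ∃ H : ℕ, 1 / √(2 ^ H : ℝ) ≤ η ∧ (H : ℝ) ≤ 2 * Real.logb 2 (1 / η) + 1 := by
  have h0 : 0 ≤ Real.logb 2 (1 / η) :=
    Real.logb_nonneg (by norm_num) (by rw [le_div_iff₀ hη]; linarith)
  refine ⟨⌈2 * Real.logb 2 (1 / η)⌉₊, ?_, (Nat.ceil_lt_add_one (by positivity)).le⟩
  set H := ⌈2 * Real.logb 2 (1 / η)⌉₊ with hH
  have h1 : 2 * Real.logb 2 (1 / η) ≤ H := Nat.le_ceil _
  have h2 : (1 / η) ^ 2 ≤ (2 : ℝ) ^ H := by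
    rw [← Real.logb_le_logb (b := 2) (by norm_num) (by positivity) (by positivity),
      Real.logb_pow, Real.logb_pow, Real.logb_self_eq_one (by norm_num)]
    push_cast; linarith
  have h3 : 1 / η ≤ √(2 ^ H : ℝ) := Real.le_sqrt_of_sq_le h2
  rw [div_le_iff₀ (by positivity)]
  rw [div_le_iff₀ hη] at h3
  linarith

/-- The choice is η = max(√ε, 1/ℓ). The lower limit `1 / ℓ` ensures that the offset, of about ℓ
bits, is absorbed by η ℓ², and it produces the term ℓ log ℓ. -/
lemma exists_threshold {ε ℓ : ℝ} (hε0 : 0 ≤ ε) (hε1 : ε ≤ 1) (hℓ : 2 ≤ ℓ) :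
    ∃ η : ℝ, 1 / ℓ ≤ η ∧ η ≤ 1 ∧ ε ≤ η ^ 2 ∧
      η * ℓ ^ 2 * (1 + Real.logb 2 (1 / η)) ≤
        2 * (√ε * ℓ ^ 2 * Real.logb 2 (2 / ε) + ℓ * Real.logb 2 ℓ) := by
  have hlog : 1 ≤ Real.logb 2 ℓ := by
    rw [Real.le_logb_iff_rpow_le (by norm_num) (by linarith)]; simpa using hℓ
  have hsq : √ε ^ 2 = ε := Real.sq_sqrt hε0
  have hℓ0 : 0 < ℓ := by linarith
  rcases le_or_gt (1 / ℓ) (√ε) with h | h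
  · have hs0 : 0 < √ε := lt_of_lt_of_le (by positivity) h
    have hε : 0 < ε := Real.sqrt_pos.1 hs0
    refine ⟨√ε, h, Real.sqrt_le_one.2 hε1, hsq.ge, ?_⟩
    have hle : Real.logb 2 ε ≤ 0 := Real.logb_nonpos (by norm_num) hε0 hε1
    have h1 : Real.logb 2 (1 / √ε) = -(Real.logb 2 ε / 2) := by
      rw [one_div, Real.logb_inv]
      have : Real.logb 2 ε = 2 * Real.logb 2 (√ε) := by
        conv_lhs => rw [← hsq]
        rw [Real.logb_pow]; norm_num
      rw [this]; ring
    have h2 : Real.logb 2 (2 / ε) = 1 - Real.logb 2 ε := by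
      rw [Real.logb_div (by norm_num) hε.ne', Real.logb_self_eq_one (by norm_num)]
    rw [h1, h2]
    have h3 : 0 ≤ √ε * ℓ ^ 2 := by positivity
    have h4 : √ε * ℓ ^ 2 * (1 + -(Real.logb 2 ε / 2)) ≤ √ε * ℓ ^ 2 * (1 - Real.logb 2 ε) := by
      gcongr; linarith
    have h5 : 0 ≤ √ε * ℓ ^ 2 * (1 - Real.logb 2 ε) := mul_nonneg h3 (by linarith)
    have h6 : 0 ≤ ℓ * Real.logb 2 ℓ := by positivity
    linarith
  · refine ⟨1 / ℓ, le_rfl, by rw [div_le_one hℓ0]; linarith, ?_, ?_⟩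
    · rw [← hsq]; gcongr
    · have h1 : 0 ≤ √ε * ℓ ^ 2 * Real.logb 2 (2 / ε) := by
        -- For `ε = 0` the factor `√0 = 0` makes the term vanish, whatever value division by zero
        -- gives to the logarithm.
        rcases hε0.eq_or_lt with rfl | hε
        · simp
        · have : 0 ≤ Real.logb 2 (2 / ε) :=
            Real.logb_nonneg (by norm_num) (by rw [le_div_iff₀ hε]; linarith)
          positivity
      rw [one_div_one_div]
      have e : 1 / ℓ * ℓ ^ 2 = ℓ := by field_simp
      rw [e]
      nlinarith

end arithmetic

/-! ### Transfer to the probability space -/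

lemma measurable_comp_countable {Ω α β : Type*} [MeasurableSpace Ω] [MeasurableSpace β]
    [Countable α] {X : Ω → α} (hX : ∀ a, MeasurableSet (X ⁻¹' {a})) (F : α → β) :
    Measurable fun ω => F (X ω) := by
  let _ : MeasurableSpace α := ⊤
  exact (measurable_from_top (f := F)).comp (measurable_to_countable' hX)

open MeasureTheory in
lemma lintegral_comp_countable {Ω α : Type*} [MeasurableSpace Ω] [Countable α] (μ : Measure Ω)
    (X : Ω → α) (hX : ∀ a, MeasurableSet (X ⁻¹' {a})) (F : α → ℝ≥0∞) :
    ∫⁻ ω, F (X ω) ∂μ = ∑' a, F a * μ (X ⁻¹' {a}) := by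
  let _ : MeasurableSpace α := ⊤
  have hXm : Measurable X := measurable_to_countable' hX
  rw [← lintegral_map (f := F) (fun _ _ => trivial) hXm, lintegral_countable']
  exact tsum_congr fun a => by rw [Measure.map_apply hXm trivial]

section probability

open MeasureTheory

variable {Ω : Type*} [MeasurableSpace Ω] {μ : Measure Ω}
  {S S' : Ω → Finset ℕ} {Δ : Ω → ℕ} {L U m : ℕ}

lemma ae_mem (hlaw : ∀ T δ, μ {ω | S ω = T ∧ Δ ω = δ} =
      ENNReal.ofReal (setProb U m T * offsetProb L δ)) :
    ∀ᵐ ω ∂μ, S ω ∈ subsets U m ∧ Δ ω ∈ Icc 1 L := by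
  have h : ∀ᵐ ω ∂μ, ∀ a : Finset ℕ × ℕ, ¬ (a.1 ∈ subsets U m ∧ a.2 ∈ Icc 1 L) →
      ¬ (S ω = a.1 ∧ Δ ω = a.2) := by
    rw [ae_all_iff]
    rintro ⟨T, δ⟩
    by_cases hb : T ∈ subsets U m ∧ δ ∈ Icc 1 L
    · exact ae_of_all _ fun ω h => absurd hb h
    · have h0 : μ {ω | S ω = T ∧ Δ ω = δ} = 0 := by
        rw [hlaw]
        rw [not_and_or] at hb
        rcases hb with hb | hb
        · rw [setProb, if_neg hb]; simp
        · rw [offsetProb, if_neg hb]; simp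
      have : ∀ᵐ ω ∂μ, ¬ (S ω = T ∧ Δ ω = δ) := by
        rw [ae_iff]; simpa using h0
      filter_upwards [this] with ω hω _ using hω
  filter_upwards [h] with ω hω
  by_contra hcon
  exact hω (S ω, Δ ω) hcon ⟨rfl, rfl⟩

lemma lintegral_eq_ofReal_sum (hS : ∀ T, MeasurableSet (S ⁻¹' {T})) (hΔ : Measurable Δ)
    (hlaw : ∀ T δ, μ {ω | S ω = T ∧ Δ ω = δ} =
      ENNReal.ofReal (setProb U m T * offsetProb L δ))
    (F : ℕ → Finset ℕ → ℝ) (hF : ∀ δ T, 0 ≤ F δ T) :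
    ∫⁻ ω, ENNReal.ofReal (F (Δ ω) (S ω)) ∂μ = ENNReal.ofReal (∑ T ∈ subsets U m,
      ∑ δ ∈ Icc 1 L, F δ T * (setProb U m T * offsetProb L δ)) := by
  have hpre : ∀ a : Finset ℕ × ℕ, (fun ω => (S ω, Δ ω)) ⁻¹' {a} = {ω | S ω = a.1 ∧ Δ ω = a.2} := by
    intro a; ext ω; simp [Prod.ext_iff]
  have ho : ∀ δ, 0 ≤ offsetProb L δ := fun δ => by unfold offsetProb; split_ifs <;> positivity
  rw [lintegral_comp_countable μ (fun ω => (S ω, Δ ω)) (fun a => ?_)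
    (fun a => ENNReal.ofReal (F a.2 a.1))]
  · rw [tsum_eq_sum (s := subsets U m ×ˢ Icc 1 L), sum_product, ENNReal.ofReal_sum_of_nonneg
      fun T _ => sum_nonneg fun δ _ => mul_nonneg (hF _ _) (mul_nonneg setProb_nonneg (ho δ))]
    · refine sum_congr rfl fun T _ => ?_
      rw [ENNReal.ofReal_sum_of_nonneg
        fun δ _ => mul_nonneg (hF _ _) (mul_nonneg setProb_nonneg (ho δ))]
      refine sum_congr rfl fun δ _ => ?_
      rw [hpre, hlaw, ENNReal.ofReal_mul (hF _ _)]
    · rintro ⟨T, δ⟩ h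
      rw [mem_product, not_and_or] at h
      rw [hpre, hlaw]
      rcases h with h | h
      · rw [setProb, if_neg h]; simp
      · rw [offsetProb, if_neg h]; simp
  · rw [hpre]
    exact (hS a.1).inter (hΔ (measurableSet_singleton a.2))

lemma integrable_one_sub_card [IsProbabilityMeasure μ] (hm : 0 < m) (hS' : ∀ T, MeasurableSet (S' ⁻¹' {T}))
    (hc : ∀ᵐ ω ∂μ, (S' ω).card ≤ m) :
    Integrable (fun ω => 1 - ((S' ω).card : ℝ) / (m : ℝ)) μ := by
  have hm' : (0 : ℝ) < m := by exact_mod_cast hm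
  have hmeas' : Measurable fun ω => 1 - ((S' ω).card : ℝ) / (m : ℝ) :=
    measurable_comp_countable hS' fun T => 1 - (T.card : ℝ) / (m : ℝ)
  refine Integrable.of_bound hmeas'.aestronglyMeasurable 1 ?_
  filter_upwards [hc] with ω hω
  have h1 : ((S' ω).card : ℝ) / m ≤ 1 := by
    rw [div_le_one hm']; exact_mod_cast hω
  have h2 : 0 ≤ ((S' ω).card : ℝ) / m := by positivity
  rw [Real.norm_eq_abs, abs_le]
  constructor <;> linarith

/-- The base part depends only on the offset and `S`, whose joint law is known; the remaining part
has mean proportional to `m * ε`. The joint law with `S'` is never needed. -/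
lemma lintegral_length_code_le [IsProbabilityMeasure μ] {K ε τ : ℝ} (hK : Regular K U m) (hL : 0 < L)
    (hS : ∀ T, MeasurableSet (S ⁻¹' {T})) (hS' : ∀ T, MeasurableSet (S' ⁻¹' {T}))
    (hΔ : Measurable Δ)
    (hlaw : ∀ T δ, μ {ω | S ω = T ∧ Δ ω = δ} =
      ENNReal.ofReal (setProb U m T * offsetProb L δ))
    (hsub : ∀ᵐ ω ∂μ, S' ω ⊆ S ω) (hε : ε = ∫ ω, (1 - ((S' ω).card : ℝ) / (m : ℝ)) ∂μ)
    (hε0 : 0 ≤ ε) (H : ℕ) (hτ : 0 < τ) :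
    ∫⁻ ω, ((code L (Δ ω) (S ω) (S' ω)).length : ℝ≥0∞) ∂μ ≤ ENNReal.ofReal
      (((2 * L.size + 3) + (8 + 4 * H) * (2 + 8 * K * m * (⌊τ⌋₊ : ℕ) / L) +
        (1 + 2 * K * (m / √L)) / 2 ^ H + 8 * K * (m / √L) * (1 / √(2 ^ H : ℝ))) +
      (8 + 4 * H) / τ * (m * ε)) := by
  have hm : 0 < m := by have := hK.two_le; omega
  have hm' : (0 : ℝ) < m := by exact_mod_cast hm
  have hK0 := hK.const_nonneg
  have hc : ∀ᵐ ω ∂μ, (S' ω).card ≤ m := by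
    filter_upwards [hsub, ae_mem hlaw] with ω h1 h2
    rw [← (mem_subsets.1 h2.1).2]; exact card_le_card h1
  have hint := integrable_one_sub_card hm hS' hc
  have h1 : ∫⁻ ω, ((code L (Δ ω) (S ω) (S' ω)).length : ℝ≥0∞) ∂μ ≤
      ∫⁻ ω, (ENNReal.ofReal (baseLength L U m H ⌊τ⌋₊ (Δ ω) (S ω)) +
        ENNReal.ofReal ((8 + 4 * H) / τ * m * (1 - ((S' ω).card : ℝ) / (m : ℝ)))) ∂μ := by
    refine lintegral_mono_ae ?_
    filter_upwards [hsub, ae_mem hlaw, hc] with ω h1 h2 h3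
    have h4 := length_code_le_baseLength h2.2 h2.1 h1 H hτ
    have h5 : 0 ≤ 1 - ((S' ω).card : ℝ) / (m : ℝ) := by
      rw [sub_nonneg, div_le_one hm']; exact_mod_cast h3
    rw [← ENNReal.ofReal_add (baseLength_nonneg _ _ _ _ _ _ _) (by positivity),
      ← ENNReal.ofReal_natCast]
    refine ENNReal.ofReal_le_ofReal (h4.trans_eq ?_)
    field_simp
  refine h1.trans ?_
  have hmeasS : ∀ a : Finset ℕ × ℕ, MeasurableSet ((fun ω => (S ω, Δ ω)) ⁻¹' {a}) := by
    intro a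
    have : (fun ω => (S ω, Δ ω)) ⁻¹' {a} = {ω | S ω = a.1 ∧ Δ ω = a.2} := by
      ext ω; simp [Prod.ext_iff]
    rw [this]
    exact (hS a.1).inter (hΔ (measurableSet_singleton a.2))
  have hbm : Measurable fun ω => ENNReal.ofReal (baseLength L U m H ⌊τ⌋₊ (Δ ω) (S ω)) :=
    measurable_comp_countable hmeasS
      fun a => ENNReal.ofReal (baseLength L U m H ⌊τ⌋₊ a.2 a.1)
  rw [lintegral_add_left hbm, lintegral_eq_ofReal_sum hS hΔ hlaw
    (fun δ T => baseLength L U m H ⌊τ⌋₊ δ T) (fun _ _ => baseLength_nonneg _ _ _ _ _ _ _),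
    ← ofReal_integral_eq_lintegral_ofReal (hint.const_mul _), integral_const_mul, ← hε]
  · rw [← mul_assoc ((8 + 4 * (H : ℝ)) / τ)]
    rw [← ENNReal.ofReal_add]
    · refine ENNReal.ofReal_le_ofReal (add_le_add_left ?_ _)
      exact hK.average_baseLength_le hL H ⌊τ⌋₊
    · refine sum_nonneg fun T _ => sum_nonneg fun δ _ => mul_nonneg (baseLength_nonneg _ _ _ _ _ _ _)
        (mul_nonneg setProb_nonneg ?_)
      unfold offsetProb; split_ifs <;> positivity
    · positivity
  · filter_upwards [hc] with ω h3
    have h5 : 0 ≤ 1 - ((S' ω).card : ℝ) / (m : ℝ) := by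
      rw [sub_nonneg, div_le_one hm']; exact_mod_cast h3
    simp only [Pi.zero_apply]
    positivity

end probability

end CatalanBlock

/-! ### Conclusion -/

theorem mainTheorem1 (α β : ℝ) (hα : 0 < α) (hβ : 0 < β) :
    ∃ C : ℝ, 0 < C ∧ ∃ B₀ : ℕ, ∀ B m U : ℕ, B₀ ≤ B → m ≤ B →
      1 ≤ CatalanBlock.intervalLen B m →
      α * (m : ℝ) ^ 2 ≤ (U : ℝ) → (U : ℝ) ≤ β * (m : ℝ) ^ 2 →
      ∀ (Ω : Type*) [MeasurableSpace Ω] (μ : MeasureTheory.Measure Ω)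
        [MeasureTheory.IsProbabilityMeasure μ]
        (S S' : Ω → Finset ℕ) (Δ : Ω → ℕ),
        (∀ T, MeasurableSet (S ⁻¹' {T})) → (∀ T, MeasurableSet (S' ⁻¹' {T})) → Measurable Δ →
        (∀ T δ, μ {ω | S ω = T ∧ Δ ω = δ} =
          ENNReal.ofReal (CatalanBlock.setProb U m T *
            CatalanBlock.offsetProb (CatalanBlock.intervalLen B m) δ)) →
        (∀ᵐ ω ∂μ, S' ω ⊆ S ω) →
        ∀ ε : ℝ, ε = ∫ ω, (1 - ((S' ω).card : ℝ) / (m : ℝ)) ∂μ →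
        ∃ ext : ℕ → Finset ℕ → Finset ℕ → List Bool,
          CatalanBlock.PrefixFree (CatalanBlock.intervalLen B m) U m ext ∧
          CatalanBlock.Determines (CatalanBlock.intervalLen B m) U m ext ∧
          ∫⁻ ω, ((ext (Δ ω) (S ω) (S' ω)).length : ℝ≥0∞) ∂μ ≤
            ENNReal.ofReal (C *
              (Real.sqrt ε * (Real.logb 2 (B : ℝ)) ^ 2 * Real.logb 2 (2 / ε) +
                Real.logb 2 (B : ℝ) * Real.logb 2 (Real.logb 2 (B : ℝ)))) := by
  obtain ⟨K, hK, hreg⟩ := CatalanBlock.exists_regular α β hα hβ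
  -- The choice of `B₀` gives ℓ ≥ 2, so that log ℓ ≥ 1, and ℓ ≥ 2 / α. As `L ≥ 1` forces m ≥ ℓ² ≥ ℓ,
  -- the latter yields `α * m ≥ 2`.
  refine ⟨2 * (46 + 212 * K), by positivity, ⌈(2 : ℝ) ^ max 2 (2 / α)⌉₊, ?_⟩
  intro B m U hB hmB hL hU1 hU2 Ω _ μ _ S S' Δ hS hS' hΔ hlaw hsub ε hε
  refine ⟨CatalanBlock.code _, CatalanBlock.prefixFree_code _ U m,
    CatalanBlock.determines_code _ U m, ?_⟩
  set L := CatalanBlock.intervalLen B m with hLdef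
  set ℓ := Real.logb 2 (B : ℝ) with hℓ
  have hBr : (2 : ℝ) ^ max 2 (2 / α) ≤ B := (Nat.le_ceil _).trans (by exact_mod_cast hB)
  have hBpos : (0 : ℝ) < B := lt_of_lt_of_le (by positivity) hBr
  have hℓmax : max 2 (2 / α) ≤ ℓ := (Real.le_logb_iff_rpow_le (by norm_num) hBpos).2 hBr
  have hℓ2 : 2 ≤ ℓ := (le_max_left _ _).trans hℓmax
  have hℓα : 2 / α ≤ ℓ := (le_max_right _ _).trans hℓmax
  have hℓ0 : 0 < ℓ := by linarith
  have hLm : (L : ℝ) ≤ (m : ℝ) ^ 2 / ℓ ^ 4 := Nat.floor_le (by positivity)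
  have hLm' : (m : ℝ) ^ 2 / ℓ ^ 4 ≤ L + 1 := (Nat.lt_floor_add_one _).le
  have hL1 : (1 : ℝ) ≤ L := by exact_mod_cast hL
  have hmℓ : ℓ ^ 2 ≤ m := by
    have h1 : ℓ ^ 4 ≤ (m : ℝ) ^ 2 := by
      have := hL1.trans hLm
      rwa [le_div_iff₀ (by positivity), one_mul] at this
    refine abs_le_of_sq_le_sq' ?_ (by positivity) |>.2
    rw [← pow_mul]; exact h1
  have hmℓ1 : ℓ ≤ m := by nlinarith
  have hm2 : 2 ≤ m := by
    have : (2 : ℝ) ≤ m := hℓ2.trans hmℓ1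
    exact_mod_cast this
  have hαm : 2 ≤ α * m := by
    rw [div_le_iff₀ hα] at hℓα
    nlinarith
  have hR := hreg m U hm2 hαm hU1 hU2
  have hm0 : (0 : ℝ) < m := by linarith
  have hbd : ∀ᵐ ω ∂μ, 0 ≤ 1 - ((S' ω).card : ℝ) / (m : ℝ) := by
    filter_upwards [hsub, CatalanBlock.ae_mem hlaw] with ω h1 h2
    rw [sub_nonneg, div_le_one hm0, ← (CatalanBlock.mem_subsets.1 h2.1).2]
    exact_mod_cast Finset.card_le_card h1
  have hε0 : 0 ≤ ε := by rw [hε]; exact MeasureTheory.integral_nonneg_of_ae hbd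
  have hε1 : ε ≤ 1 := by
    rw [hε]
    calc _ ≤ ∫ _, (1 : ℝ) ∂μ := by
          refine MeasureTheory.integral_mono_of_nonneg hbd (MeasureTheory.integrable_const _)
            (Filter.Eventually.of_forall fun ω => ?_)
          exact sub_le_self _ (by positivity)
      _ = 1 := by simp
  obtain ⟨η, hη, hη1, hεη, hfin⟩ := CatalanBlock.exists_threshold hε0 hε1 hℓ2
  have hη0 : 0 < η := lt_of_lt_of_le (by positivity) hη
  obtain ⟨H, hH, hH'⟩ := CatalanBlock.exists_exponent hη0 hη1
  -- This threshold `τ` balances the sparse intervals, about m τ / L or η ℓ², against the lost dense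
  -- ones, at most m ε / τ = ℓ² ε / η ≤ η ℓ².
  refine (CatalanBlock.lintegral_length_code_le hR hL hS hS' hΔ hlaw hsub hε hε0 H
    (τ := η * m / ℓ ^ 2) (by positivity)).trans (ENNReal.ofReal_le_ofReal ?_)
  refine (CatalanBlock.total_length_le hK.le hℓ (by linarith) hmB hL hLm hLm' hη hη1 hεη hH
    hH').trans ?_
  calc _ ≤ (46 + 212 * K) * (2 * (√ε * ℓ ^ 2 * Real.logb 2 (2 / ε) + ℓ * Real.logb 2 ℓ)) := by
        gcongr
    _ = _ := by ring
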